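/- Let $N\in\mathbb N$ and $Q=(-\tfrac12,\tfrac12)^N\subset\mathbb R^N$. A first order operator is $\mathscr B v=\sum_{i=1}^N B^i\,\partial_i v$, where each $B^i$ is a linear map from $\mathbb R^N$ to $\mathbb R^{N\times N}$ (a third order tensor), acting on $\mathbb R^N$-valued distributions. For an open set $U\subset\mathbb R^N$ let $$BV_{\mathscr B}(U;\mathbb R^N)=\{u\in L^1(U;\mathbb R^N):\ \mathscr B u\in\mathcal M_b(U;\mathbb R^{N\times N})\},\qquad \|u\|_{BV_{\mathscr B}(U)}=\|u\|_{L^1(U;\mathbb R^N)}+|\mathscr B u|_{\mathcal M_b(U;\mathbb R^{N\times N})},$$ where $\mathcal M_b$ denotes finite vector-valued Borel measures and $|\cdot|_{\mathcal M_b}$ the total variation with respect to the Euclidean norm. Let $\mathscr A u=\sum_{|a|\le d}A_a\,\partial^a u$ be a differential operator of order $d\in\mathbb N$ on $\mathbb R^N$-valued distributions, with constant coefficients $A_a\in\mathbb R^{N\times N}$. Let $\Pi_{\mathscr A}$ be the set of all first order operators $\mathscr B$ such that $(\mathscr A,\mathscr B)$ is a training operator pair, that is: (0) the null-space $\{v\in\mathcal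 D'(\mathbb R^N;\mathbb R^N):\mathscr B v=0\}$ is finite dimensional; (1) for every $\lambda\in\{-1,1\}^N$ there is $P_\lambda\in L^1_{\rm loc}(\mathbb R^N;\mathbb R^N)$ with $\mathscr A P_\lambda=\lambda\delta_0$, $P_\lambda\in C^\infty(\mathbb R^N\setminus\{0\};\mathbb R^N)$, $\partial^aP_\lambda\in L^1_{\rm loc}(\mathbb R^N;\mathbb R^N)$ for all $|a|\le d-1$, and, for every bounded open $U\supseteq Q$, $$\sum_{|a|=d-1}\|\partial^aP_\lambda(\cdot+h)-\partial^aP_\lambda\|_{L^1(U;\mathbb R^N)}\to0\quad\text{as }|h|\to0;$$ (2) there is a constant $C$ such that for every open $U\supseteq Q$ and every $i=1,\dots,N$ $$\|(\mathscr A u)_i*v_i\|_{L^1}\le C\Big[\sum_{|a|\le d-1}\|\partial^au\|_{L^1(U;\mathbb R^N)}\Big]|\mathscr B v|_{\mathcal M_b(U;\mathbb R^{N\times N})}$$ for all $u\in W^{d,1}(U;\mathbb R^N)$, $v\in C_c^\infty(U;\mathbb R^N)$, and also for all $u\in C^\infty_c(U;\mathbb R^N)$, $v\in BV_{\mathscr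 B}(U;\mathbb R^N)$. Here the $L^1$ norm on the left is taken over the set where the convolution of functions on $U$ is defined, namely $\{x\in U: x-K\subset U\}$, with $K=\operatorname{supp}v$ in the first case and $K=\operatorname{supp}u$ in the second (this set is $\mathbb R^N$ if $U=\mathbb R^N$). Then for every $\mathscr B\in\Pi_{\mathscr A}$ the injection of $BV_{\mathscr B}(Q;\mathbb R^N)$ into $L^1(Q;\mathbb R^N)$ is a compact operator. -/

import Mathlib

open Set Filter Topology MeasureTheory TopologicalSpace
open scoped ENNReal NNReal ContDiff Distributions LineDeriv

noncomputable section

namespace BVB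

/-- The space `ℝ^N` with its Euclidean norm. -/
abbrev Vec (N : ℕ) := EuclideanSpace ℝ (Fin N)

/-- The space `ℝ^{N×N}` of real matrices with the Euclidean (Frobenius) norm. -/
abbrev Mat (N : ℕ) := EuclideanSpace ℝ (Fin N × Fin N)

/-- The `i`-th vector of the standard basis of `ℝ^N`. -/
def e {N : ℕ} (i : Fin N) : Vec N := EuclideanSpace.single i 1

/-- The open unit cube `Q = (-1/2, 1/2)^N`. -/
def Q (N : ℕ) : Opens (Vec N) where
  carrier := {x | ∀ i, x i ∈ Ioo (-(1 / 2) : ℝ) (1 / 2)}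
  is_open' := by
    simp only [ofPred_forall]
    exact isOpen_iInter_of_finite fun i => isOpen_Ioo.preimage (by fun_prop)

/-! ### Functions as distributions and distributional derivatives -/

section Distributions

variable {N : ℕ} {F : Type*} [NormedAddCommGroup F] [NormedSpace ℝ F]

/-- The distribution `φ ↦ ∫ φ u` on `U` of a function `u` that is locally integrable on `U`
(the zero distribution if `u` is not locally integrable on `U`). -/
def toDist (U : Opens (Vec N)) (u : Vec N → F) : 𝓓'(U, F) :=
  ContinuousLinearMap.toUniformConvergenceCLM _ F _
    (TestFunction.integralAgainstBilinCLM (ContinuousLinearMap.lsmul ℝ ℝ) volume u)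

lemma toDist_apply {U : Opens (Vec N)} {u : Vec N → F} (hu : LocallyIntegrableOn u U)
    (φ : 𝓓(U, ℝ)) : toDist U u φ = ∫ x, φ x • u x := by
  change TestFunction.integralAgainstBilinCLM (ContinuousLinearMap.lsmul ℝ ℝ) volume u φ = _
  rw [TestFunction.integralAgainstBilinCLM_eq_integral hu]
  simp

lemma integrable_smul_test {U : Opens (Vec N)} {u : Vec N → F} (hu : LocallyIntegrableOn u U)
    (φ : 𝓓(U, ℝ)) : Integrable (fun x => φ x • u x) := by
  simpa using TestFunction.integrable_bilin (ContinuousLinearMap.lsmul ℝ ℝ) hu φ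

lemma toDist_zero (U : Opens (Vec N)) : toDist U (0 : Vec N → F) = 0 := by
  ext φ
  rw [toDist_apply (LocallyIntegrable.locallyIntegrableOn (locallyIntegrable_zero) _)]
  simp only [Pi.zero_apply, smul_zero, integral_zero]
  rfl

lemma toDist_add {U : Opens (Vec N)} {u v : Vec N → F}
    (hu : LocallyIntegrableOn u U) (hv : LocallyIntegrableOn v U) :
    toDist U (u + v) = toDist U u + toDist U v := by
  ext φ
  change _ = toDist U u φ + toDist U v φ
  rw [toDist_apply hu, toDist_apply hv, toDist_apply (hu.add hv),
    ← integral_add (integrable_smul_test hu φ) (integrable_smul_test hv φ)]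
  simp

lemma toDist_smul {U : Opens (Vec N)} {u : Vec N → F} (hu : LocallyIntegrableOn u U) (c : ℝ) :
    toDist U (c • u) = c • toDist U u := by
  ext φ
  change _ = c • toDist U u φ
  rw [toDist_apply hu, toDist_apply (hu.smul c), ← integral_smul]
  simp [smul_comm c]

lemma toDist_congr {U : Opens (Vec N)} {u v : Vec N → F} (hu : LocallyIntegrableOn u U)
    (h : u =ᵐ[volume.restrict U] v) : toDist U u = toDist U v := by
  have hv : LocallyIntegrableOn v U := by
    rw [locallyIntegrableOn_iff (Or.inr U.isOpen.isLocallyClosed |>.elim id id)] at hu ⊢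
    intro K hK hc
    exact (hu K hK hc).congr (ae_mono (Measure.restrict_mono hK le_rfl) h)
  ext φ
  rw [toDist_apply hu, toDist_apply hv]
  refine integral_congr_ae ?_
  rw [Filter.EventuallyEq, ae_restrict_iff' U.isOpen.measurableSet] at h
  filter_upwards [h] with x hx
  by_cases hxU : x ∈ (U : Set (Vec N))
  · rw [hx hxU]
  · have : φ x = 0 := image_eq_zero_of_notMem_tsupport fun hs => hxU (φ.tsupport_subset hs)
    simp [this]

/-- The distributional derivative `∂^a = ∂_1^{a_1} ⋯ ∂_N^{a_N}` for a multi-index `a`. -/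
def mderiv {U : Opens (Vec N)} (a : Fin N → ℕ) (T : 𝓓'(U, F)) : 𝓓'(U, F) :=
  (List.finRange N).foldr (fun i S => (fun R : 𝓓'(U, F) => ∂_{e i} R)^[a i] S) T

end Distributions

/-- The finite set of all multi-indices `a` in `N` variables with `|a| ≤ k`. -/
def multiIdx (N k : ℕ) : Finset (Fin N → ℕ) :=
  (Fintype.piFinset fun _ => Finset.range (k + 1)).filter fun a => ∑ i, a i ≤ k

lemma mem_multiIdx {N k : ℕ} (a : Fin N → ℕ) : a ∈ multiIdx N k ↔ ∑ i, a i ≤ k := by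
  simp only [multiIdx, Finset.mem_filter, Fintype.mem_piFinset, Finset.mem_range, and_iff_right_iff_imp]
  intro h i
  exact Nat.lt_succ_of_le ((Finset.single_le_sum (fun _ _ => Nat.zero_le _) (Finset.mem_univ i)).trans h)

/-- `u ∈ W^{k,1}(U; ℝ^N)`, and `Du a` is (a representative of) its weak derivative `∂^a u` for
every multi-index `a` with `|a| ≤ k`. -/
structure IsSobolev {N : ℕ} (U : Opens (Vec N)) (k : ℕ) (u : Vec N → Vec N)
    (Du : (Fin N → ℕ) → Vec N → Vec N) : Prop where
  integrableOn : IntegrableOn u U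
  integrableOn_deriv : ∀ a, ∑ i, a i ≤ k → IntegrableOn (Du a) U
  deriv_eq : ∀ a, ∑ i, a i ≤ k → mderiv a (toDist U u) = toDist U (Du a)

/-! ### Differential operators with constant coefficients -/

/-- A first order operator `𝓑 v = ∑ i, B^i ∂_i v` taking `ℝ^N`-valued distributions to
`ℝ^{N×N}`-valued ones. The third order tensor `B^i = (B^i_{ljk})` is given as the linear map
`ℝ^N → ℝ^{N×N}`, `(B^i w)_{lj} = ∑ k, B^i_{ljk} w_k`. -/
abbrev FirstOrderOp (N : ℕ) := Fin N → (Vec N →L[ℝ] Mat N)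

/-- The action `𝓑 T = ∑ i, B^i ∂_i T` on distributions. -/
def FirstOrderOp.onDist {N : ℕ} (B : FirstOrderOp N) (U : Opens (Vec N)) :
    𝓓'(U, Vec N) →L[ℝ] 𝓓'(U, Mat N) :=
  ∑ i, (Distribution.mapCLM (B i)).comp (Distribution.lineDerivCLM (e i))

/-- The null-space `𝓝(𝓑)` of `𝓑` in the space of `ℝ^N`-valued distributions on `ℝ^N`. -/
def FirstOrderOp.nullSpace {N : ℕ} (B : FirstOrderOp N) :
    Submodule ℝ 𝓓'((⊤ : Opens (Vec N)), Vec N) :=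
  LinearMap.ker (B.onDist ⊤).toLinearMap

/-- A differential operator `𝓐 u = ∑_{|a| ≤ d} A_a ∂^a u` of order `d` acting on `ℝ^N`-valued
distributions (the coefficients `A_a` with `|a| > d` play no role). -/
structure DiffOp (N : ℕ) where
  order : ℕ
  coeff : (Fin N → ℕ) → (Vec N →L[ℝ] Vec N)

namespace DiffOp

variable {N : ℕ}

/-- The action of `𝓐` on distributions. -/
def onDist (A : DiffOp N) (U : Opens (Vec N)) (T : 𝓓'(U, Vec N)) : 𝓓'(U, Vec N) :=
  ∑ a ∈ multiIdx N A.order, Distribution.mapCLM (A.coeff a) (mderiv a T)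

/-- The function `∑_{|a| ≤ d} A_a (∂^a u)(x)`, where `Du a` is the derivative `∂^a u`. -/
def onDerivs (A : DiffOp N) (Du : (Fin N → ℕ) → Vec N → Vec N) (x : Vec N) : Vec N :=
  ∑ a ∈ multiIdx N A.order, A.coeff a (Du a x)

end DiffOp

/-! ### The total variation of `𝓑 u` and the space `BV_𝓑` -/

section BV

variable {N : ℕ}

/-- The finite `ℝ^{N×N}`-valued measure `μ` is equal to the distribution `𝓑 u` on `U`.
(Measures on `U` are given as restrictions of measures on `ℝ^N`.) -/
structure Represents (B : FirstOrderOp N) (U : Opens (Vec N)) (u : Vec N → Vec N)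
    (μ : VectorMeasure (Vec N) (Mat N)) : Prop where
  finite : IsFiniteMeasure μ.variation
  eq : ∀ φ : 𝓓(U, ℝ), B.onDist U (toDist U u) φ = ∫ᵛ x, φ x ∂•μ

/-- The norm `|𝓑 u|_{𝓜_b(U; ℝ^{N×N})}` for `u` locally integrable on `U`: the total variation `|μ|(U)` if the distribution `𝓑 u` is
a finite measure `μ` on `U` (this number does not depend on the choice of the extension `μ` of
that measure to `ℝ^N`), and `∞` if `𝓑 u` is not a finite measure on `U`. -/
def totalVar (B : FirstOrderOp N) (U : Opens (Vec N)) (u : Vec N → Vec N) : ℝ≥0∞ :=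
  ⨅ (μ : VectorMeasure (Vec N) (Mat N)) (_ : Represents B U u μ), μ.variation U

lemma Represents.zero (B : FirstOrderOp N) (U : Opens (Vec N)) : Represents B U 0 0 where
  finite := by rw [VectorMeasure.variation_zero]; infer_instance
  eq φ := by
    rw [toDist_zero, map_zero, VectorMeasure.integral_zero_vectorMeasure]
    rfl

lemma integrable_test {U : Opens (Vec N)} (φ : 𝓓(U, ℝ)) (μ : VectorMeasure (Vec N) (Mat N))
    [IsFiniteMeasure μ.variation] : μ.Integrable φ :=
  φ.continuous.integrable_of_hasCompactSupport φ.hasCompactSupport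

lemma Represents.add {B : FirstOrderOp N} {U : Opens (Vec N)} {u v : Vec N → Vec N}
    {μ ν : VectorMeasure (Vec N) (Mat N)} (hu : LocallyIntegrableOn u U)
    (hv : LocallyIntegrableOn v U) (hμ : Represents B U u μ) (hν : Represents B U v ν) :
    Represents B U (u + v) (μ + ν) := by
  have := hμ.finite
  have := hν.finite
  refine ⟨isFiniteMeasure_of_le _ VectorMeasure.variation_add_le, fun φ => ?_⟩
  rw [toDist_add hu hv, map_add, VectorMeasure.integral_add_vectorMeasure
    (integrable_test φ μ) (integrable_test φ ν), ← hμ.eq, ← hν.eq]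
  rfl

lemma Represents.smul {B : FirstOrderOp N} {U : Opens (Vec N)} {u : Vec N → Vec N}
    {μ : VectorMeasure (Vec N) (Mat N)} (hu : LocallyIntegrableOn u U)
    (hμ : Represents B U u μ) (c : ℝ) : Represents B U (c • u) (c • μ) := by
  have := hμ.finite
  refine ⟨inferInstance, fun φ => ?_⟩
  rw [toDist_smul hu, map_smul, VectorMeasure.integral_smul_vectorMeasure, ← hμ.eq]
  rfl

lemma totalVar_zero (B : FirstOrderOp N) (U : Opens (Vec N)) : totalVar B U 0 = 0 :=
  le_antisymm ((iInf₂_le _ (Represents.zero B U)).trans (by simp)) zero_le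

lemma totalVar_add_le (B : FirstOrderOp N) {U : Opens (Vec N)} {u v : Vec N → Vec N}
    (hu : LocallyIntegrableOn u U) (hv : LocallyIntegrableOn v U) :
    totalVar B U (u + v) ≤ totalVar B U u + totalVar B U v := by
  simp only [totalVar, ENNReal.iInf_add, ENNReal.add_iInf]
  refine le_iInf₂ fun ν hν => le_iInf₂ fun μ hμ => ?_
  exact (iInf₂_le _ (hμ.add hu hv hν)).trans (VectorMeasure.variation_add_le _)

lemma totalVar_smul_le (B : FirstOrderOp N) {U : Opens (Vec N)} {u : Vec N → Vec N}
    (hu : LocallyIntegrableOn u U) (c : ℝ) :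
    totalVar B U (c • u) ≤ ‖c‖ₑ * totalVar B U u := by
  rcases eq_or_ne c 0 with rfl | hc
  · simp [totalVar_zero]
  simp only [totalVar]
  rw [ENNReal.mul_iInf_of_ne (by simpa using hc) (by simp)]
  refine le_iInf fun μ => ?_
  rw [ENNReal.mul_iInf_of_ne (by simpa using hc) (by simp)]
  refine le_iInf fun hμ => (iInf₂_le _ (hμ.smul hu c)).trans ?_
  rw [VectorMeasure.variation_smul]
  simp [enorm_eq_nnnorm]

lemma totalVar_congr (B : FirstOrderOp N) {U : Opens (Vec N)} {u v : Vec N → Vec N}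
    (hu : LocallyIntegrableOn u U) (h : u =ᵐ[volume.restrict U] v) :
    totalVar B U u = totalVar B U v := by
  have : ∀ μ, Represents B U u μ ↔ Represents B U v μ := fun μ =>
    ⟨fun h' => ⟨h'.finite, toDist_congr hu h ▸ h'.eq⟩,
      fun h' => ⟨h'.finite, (toDist_congr hu h).symm ▸ h'.eq⟩⟩
  simp only [totalVar, this]

/-- The space `L¹(U; ℝ^N)`. -/
abbrev L1 (U : Opens (Vec N)) := Lp (Vec N) 1 (volume.restrict (U : Set (Vec N)))

lemma L1_locallyIntegrableOn {U : Opens (Vec N)} (u : L1 U) : LocallyIntegrableOn u U :=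
  IntegrableOn.locallyIntegrableOn (L1.integrable_coeFn u)

lemma totalVar_coe_add_le (B : FirstOrderOp N) {U : Opens (Vec N)} (u v : L1 U) :
    totalVar B U (u + v : L1 U) ≤ totalVar B U u + totalVar B U v := by
  rw [totalVar_congr B (L1_locallyIntegrableOn _) (Lp.coeFn_add u v)]
  exact totalVar_add_le B (L1_locallyIntegrableOn u) (L1_locallyIntegrableOn v)

lemma totalVar_coe_smul_le (B : FirstOrderOp N) {U : Opens (Vec N)} (c : ℝ) (u : L1 U) :
    totalVar B U (c • u : L1 U) ≤ ‖c‖ₑ * totalVar B U u := by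
  rw [totalVar_congr B (L1_locallyIntegrableOn _) (Lp.coeFn_smul c u)]
  exact totalVar_smul_le B (L1_locallyIntegrableOn u) c

lemma totalVar_coe_smul (B : FirstOrderOp N) {U : Opens (Vec N)} (c : ℝ) (u : L1 U) :
    totalVar B U (c • u : L1 U) = ‖c‖ₑ * totalVar B U u := by
  refine le_antisymm (totalVar_coe_smul_le B c u) ?_
  rcases eq_or_ne c 0 with rfl | hc
  · simp
  calc ‖c‖ₑ * totalVar B U u = ‖c‖ₑ * totalVar B U (c⁻¹ • c • u : L1 U) := by
        rw [inv_smul_smul₀ hc]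
    _ ≤ ‖c‖ₑ * (‖c⁻¹‖ₑ * totalVar B U (c • u : L1 U)) := by
        gcongr
        exact totalVar_coe_smul_le B _ _
    _ = totalVar B U (c • u : L1 U) := by
        rw [← mul_assoc, ← enorm_mul, mul_inv_cancel₀ hc]
        simp

/-- The functions `u ∈ L¹(U; ℝ^N)` such that `𝓑 u` is a finite measure, as a subspace of
`L¹(U; ℝ^N)`. -/
def bvSubmodule (B : FirstOrderOp N) (U : Opens (Vec N)) : Submodule ℝ (L1 U) where
  carrier := {u | totalVar B U u ≠ ⊤}
  zero_mem' := by
    change totalVar B U ((0 : L1 U) : Vec N → Vec N) ≠ ⊤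
    rw [totalVar_congr B (L1_locallyIntegrableOn _) (Lp.coeFn_zero _ _ _), totalVar_zero]
    exact ENNReal.zero_ne_top
  add_mem' {u v} hu hv :=
    ((totalVar_coe_add_le B u v).trans_lt (ENNReal.add_lt_top.2 ⟨lt_top_iff_ne_top.2 hu,
      lt_top_iff_ne_top.2 hv⟩)).ne
  smul_mem' c u hu :=
    ((totalVar_coe_smul_le B c u).trans_lt (ENNReal.mul_lt_top (by simp)
      (lt_top_iff_ne_top.2 hu))).ne

/-- The space `BV_𝓑(U; ℝ^N)`. It carries the norm `‖u‖_{L¹(U)} + |𝓑 u|_{𝓜_b(U)}` defined below,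
not the norm of `L¹`. -/
def BV (B : FirstOrderOp N) (U : Opens (Vec N)) : Type := bvSubmodule B U

namespace BV

variable (B : FirstOrderOp N) (U : Opens (Vec N))

instance : AddCommGroup (BV B U) := inferInstanceAs (AddCommGroup (bvSubmodule B U))

instance : Module ℝ (BV B U) := inferInstanceAs (Module ℝ (bvSubmodule B U))

/-- The injection of `BV_𝓑(U; ℝ^N)` into `L¹(U; ℝ^N)`. -/
def toL1 : BV B U →ₗ[ℝ] L1 U := (bvSubmodule B U).subtype

instance : Norm (BV B U) where
  norm u := ‖toL1 B U u‖ + (totalVar B U (toL1 B U u)).toReal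

variable {B U}

lemma norm_def (u : BV B U) : ‖u‖ = ‖toL1 B U u‖ + (totalVar B U (toL1 B U u)).toReal := rfl

lemma totalVar_ne_top (u : BV B U) : totalVar B U (toL1 B U u) ≠ ⊤ := u.2

variable (B U)

lemma normedSpaceCore : NormedSpace.Core ℝ (BV B U) where
  norm_nonneg u := by rw [norm_def]; positivity
  norm_smul c u := by
    rw [norm_def, norm_def, map_smul, norm_smul, totalVar_coe_smul, ENNReal.toReal_mul,
      toReal_enorm, mul_add]
  norm_triangle u v := by
    have h := ENNReal.toReal_mono (ENNReal.add_ne_top.2 ⟨u.totalVar_ne_top, v.totalVar_ne_top⟩)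
      (totalVar_coe_add_le B (toL1 B U u) (toL1 B U v))
    rw [ENNReal.toReal_add u.totalVar_ne_top v.totalVar_ne_top] at h
    have h' := norm_add_le (toL1 B U u) (toL1 B U v)
    simp only [norm_def, map_add]
    linarith
  norm_eq_zero_iff u := by
    constructor
    · intro h
      rw [norm_def] at h
      have h1 : ‖toL1 B U u‖ = 0 :=
        le_antisymm (by linarith [ENNReal.toReal_nonneg (a := totalVar B U (toL1 B U u))])
          (norm_nonneg _)
      exact Subtype.ext (norm_eq_zero.1 h1)
    · rintro rfl
      have h := totalVar_coe_smul B 0 (toL1 B U 0)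
      simp only [zero_smul, enorm_zero, zero_mul] at h
      rw [norm_def, map_zero, h, norm_zero, ENNReal.toReal_zero, add_zero]

instance : NormedAddCommGroup (BV B U) := NormedAddCommGroup.ofCore (normedSpaceCore B U)

instance : NormedSpace ℝ (BV B U) := NormedSpace.ofCore (normedSpaceCore B U)

end BV

end BV

/-! ### Training operator pairs -/

section Pairs

variable {N : ℕ}

/-- Properties of a fundamental solution `P` of `𝓐` with `𝓐 P = lam δ`: it is locally integrable,
smooth away from the origin, its derivatives `DP a = ∂^a P` of order `|a| ≤ d - 1` are locally
integrable functions, and those of order `d - 1` depend continuously in `L¹(U)` on translations at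
the translation `0`, for every bounded open `U ⊇ Q`. -/
structure IsFundamentalSolution (A : DiffOp N) (lam : Vec N) (P : Vec N → Vec N)
    (DP : (Fin N → ℕ) → Vec N → Vec N) : Prop where
  locallyIntegrable : LocallyIntegrable P
  eq_delta : ∀ φ : 𝓓((⊤ : Opens (Vec N)), ℝ), A.onDist ⊤ (toDist ⊤ P) φ = φ 0 • lam
  smooth : ContDiffOn ℝ ∞ P {0}ᶜ
  locallyIntegrable_deriv : ∀ a, ∑ i, a i < A.order → LocallyIntegrable (DP a)
  deriv_eq : ∀ a, ∑ i, a i < A.order → mderiv a (toDist ⊤ P) = toDist ⊤ (DP a)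
  translation : ∀ U : Opens (Vec N), Q N ≤ U → Bornology.IsBounded (U : Set (Vec N)) →
    Tendsto (fun h : Vec N => ∑ a ∈ multiIdx N A.order with (∑ i, a i) + 1 = A.order,
      ∫⁻ x in U, ‖DP a (x + h) - DP a x‖ₑ) (𝓝 0) (𝓝 0)

/-- The points `x ∈ U` with `x - K ⊆ U`. If one of two functions on `U` has support in `K`, their
convolution at such an `x` involves only values of the other one at points of `U`. -/
def convDomain (U : Opens (Vec N)) (K : Set (Vec N)) : Set (Vec N) :=
  {x | x ∈ U ∧ ∀ y ∈ K, x - y ∈ U}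

/-- The `L¹` norm, over the part `convDomain U K` of `U` on which it is defined, of the convolution
`f ∗ g` of two functions on `U` one of which has its support in `K`. -/
def convNorm (U : Opens (Vec N)) (K : Set (Vec N)) (f g : Vec N → ℝ) : ℝ≥0∞ :=
  ∫⁻ x in convDomain U K,
    ‖convolution ((U : Set (Vec N)).indicator f) ((U : Set (Vec N)).indicator g)
      (ContinuousLinearMap.mul ℝ ℝ) volume x‖ₑ

/-- `∑_{|a| ≤ d - 1} ‖∂^a u‖_{L¹(U; ℝ^N)}`, where `Du a` is the derivative `∂^a u`. -/
def lowerNorm (U : Opens (Vec N)) (d : ℕ) (Du : (Fin N → ℕ) → Vec N → Vec N) : ℝ≥0∞ :=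
  ∑ a ∈ multiIdx N d with ∑ i, a i < d, ∫⁻ x in U, ‖Du a x‖ₑ

/-- `(𝓐, 𝓑)` is a training operator pair. -/
structure IsTrainingPair (A : DiffOp N) (B : FirstOrderOp N) : Prop where
  finite_nullSpace : FiniteDimensional ℝ B.nullSpace
  fundamental : ∀ lam : Vec N, (∀ i, lam i = -1 ∨ lam i = 1) →
    ∃ P DP, IsFundamentalSolution A lam P DP
  convolution_bound : ∃ C : ℝ≥0, ∀ U : Opens (Vec N), Q N ≤ U →
    (∀ u Du, IsSobolev U A.order u Du → ∀ (v : 𝓓(U, Vec N)) (i : Fin N),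
      convNorm U (tsupport v) (fun x => A.onDerivs Du x i) (fun x => v x i) ≤
        C * lowerNorm U A.order Du * totalVar B U v) ∧
    (∀ (u : 𝓓(U, Vec N)) (Du), IsSobolev U A.order u Du →
      ∀ v : Vec N → Vec N, IntegrableOn v U → totalVar B U v ≠ ⊤ → ∀ i : Fin N,
      convNorm U (tsupport u) (fun x => A.onDerivs Du x i) (fun x => v x i) ≤
        C * lowerNorm U A.order Du * totalVar B U v)

/-- The class `Π_𝓐` of all first order operators `𝓑` such that `(𝓐, 𝓑)` is a training operator
pair. -/
def PiClass (A : DiffOp N) : Set (FirstOrderOp N) := {B | IsTrainingPair A B}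

end Pairs

end BVB

end

/-! If the null-space of `B` is finite dimensional, it cannot contain nonzero homogeneous
polynomials of every positive degree, since polynomials of different degrees are linearly
independent. So in some degree `m + 1` the symbol of `B` is injective on symmetric tensors
(`exists_symbol_injective`), and every derivative of `v` of order `m + 1` is a linear combination of
derivatives of `B v` of order `m` (`exists_symbol_leftInverse`).

Expand a smooth `v` in a Taylor polynomial about `x + t (z - x)`, evaluate at `x` and average over
`z` with a smooth weight. The remainder contains `s ^ m` times derivatives of order `m + 1` at `x +
s (z - x)`. Rewrite these through `B v` and integrate by parts `m` times in `z`: each step costs a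
factor `s`, and `s ^ m` pays for all of them. What remains (`averaged_taylor`) is `v x = ∫ K(x,z)
v(x + t (z - x)) dz + ∫₀ᵗ ∫ R(x,z) (B v)(x + s (z - x)) dz ds`, with continuous kernels independent
of `s` and `t`.

The last term has `L¹` norm at most `C t` times that of `B v` (`exists_taylorAverage_estimate`), and
mollification carries this over to `u` in `BV_B` (`exists_taylorAverage_estimate_totalVar`). For
fixed `t > 0` the first term is an integral operator with continuous kernel, hence approximable by
maps into compact sets (`exists_compact_approx`). The unit ball of `BV_B(Q)` is thus within any
prescribed `L¹` distance of a compact set, so it is totally bounded (`totallyBounded_image_toL1`).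
-/

noncomputable section

namespace BVB

/-! ### Iterated partial derivatives -/

section PartialDerivatives

variable {N : ℕ} {F G : Type*} [NormedAddCommGroup F] [NormedSpace ℝ F]
  [NormedAddCommGroup G] [NormedSpace ℝ G]

/-- The partial derivative `∂_i f`. -/
def pd (i : Fin N) (f : Vec N → F) : Vec N → F := fun y => fderiv ℝ f y (e i)

/-- The iterated partial derivative `∂_{i₁} ⋯ ∂_{iₖ} f` for a list `[i₁, …, iₖ]`. -/
def pdl (l : List (Fin N)) (f : Vec N → F) : Vec N → F := l.foldr pd f

@[simp] lemma pdl_nil (f : Vec N → F) : pdl [] f = f := rfl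

@[simp] lemma pdl_cons (i : Fin N) (l : List (Fin N)) (f : Vec N → F) :
    pdl (i :: l) f = pd i (pdl l f) := rfl

lemma pdl_append (l l' : List (Fin N)) (f : Vec N → F) :
    pdl (l ++ l') f = pdl l (pdl l' f) := by simp [pdl]

lemma contDiff_pd {f : Vec N → F} (hf : ContDiff ℝ ∞ f) (i : Fin N) : ContDiff ℝ ∞ (pd i f) :=
  (hf.fderiv_right (by simp)).clm_apply contDiff_const

lemma contDiff_pdl {f : Vec N → F} (hf : ContDiff ℝ ∞ f) (l : List (Fin N)) :
    ContDiff ℝ ∞ (pdl l f) := by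
  induction l with
  | nil => exact hf
  | cons i l ih => exact contDiff_pd ih i

lemma differentiable_of_smooth {f : Vec N → F} (hf : ContDiff ℝ ∞ f) : Differentiable ℝ f :=
  hf.differentiable (by simp)

lemma pd_comm {f : Vec N → F} (hf : ContDiff ℝ ∞ f) (i j : Fin N) :
    pd i (pd j f) = pd j (pd i f) := by
  have hd : Differentiable ℝ (fderiv ℝ f) :=
    (hf.fderiv_right (m := ∞) (by simp)).differentiable (by simp)
  have h : ∀ (k l : Fin N) (y : Vec N), pd k (pd l f) y = fderiv ℝ (fderiv ℝ f) y (e k) (e l) := by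
    intro k l y
    change fderiv ℝ (fun y => fderiv ℝ f y (e l)) y (e k) = _
    rw [fderiv_clm_apply (hd y) (differentiableAt_const _)]
    simp
  ext1 y
  rw [h, h]
  exact (hf.contDiffAt.isSymmSndFDerivAt (by simpa using (WithTop.coe_le_coe.2 le_top : ((2 : ℕ∞) : ℕ∞ω) ≤ ((⊤ : ℕ∞) : ℕ∞ω)))).eq _ _

lemma pdl_perm {f : Vec N → F} (hf : ContDiff ℝ ∞ f) {l l' : List (Fin N)} (h : l.Perm l') :
    pdl l f = pdl l' f := by
  induction h with
  | nil => rfl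
  | cons i _ ih => simp [ih]
  | swap i j l => exact pd_comm (contDiff_pdl hf l) j i
  | trans _ _ h₁ h₂ => exact h₁.trans h₂

lemma e_apply (i j : Fin N) : (e i : Vec N) j = if j = i then 1 else 0 := by
  simp [e]

lemma sum_smul_e (h : Vec N) : h = ∑ i, h i • (e i : Vec N) := by
  ext j
  simp [e_apply]

lemma fderiv_eq_sum_pd (f : Vec N → F) (y h : Vec N) :
    fderiv ℝ f y h = ∑ i, h i • pd i f y := by
  conv_lhs => rw [sum_smul_e h]
  simp [pd]

lemma pd_clm_comp {f : Vec N → F} (hf : Differentiable ℝ f) (L : F →L[ℝ] G) (i : Fin N) :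
    pd i (fun y => L (f y)) = fun y => L (pd i f y) := by
  ext1 y
  change fderiv ℝ (L ∘ f) y (e i) = _
  rw [(L.hasFDerivAt.comp y (hf y).hasFDerivAt).fderiv]
  rfl

lemma pdl_clm_comp {f : Vec N → F} (hf : ContDiff ℝ ∞ f) (L : F →L[ℝ] G) (l : List (Fin N)) :
    pdl l (fun y => L (f y)) = fun y => L (pdl l f y) := by
  induction l with
  | nil => rfl
  | cons i l ih =>
    rw [pdl_cons, ih, pd_clm_comp (differentiable_of_smooth (contDiff_pdl hf l))]
    rfl

lemma pd_sum {ι : Type*} (s : Finset ι) {f : ι → Vec N → F}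
    (hf : ∀ j ∈ s, Differentiable ℝ (f j)) (i : Fin N) :
    pd i (fun y => ∑ j ∈ s, f j y) = fun y => ∑ j ∈ s, pd i (f j) y := by
  ext1 y
  change fderiv ℝ (fun y => ∑ j ∈ s, f j y) y (e i) = _
  rw [fderiv_fun_sum fun j hj => (hf j hj) y]
  simp [pd]

lemma pdl_sum {ι : Type*} (s : Finset ι) {f : ι → Vec N → F}
    (hf : ∀ j ∈ s, ContDiff ℝ ∞ (f j)) (l : List (Fin N)) :
    pdl l (fun y => ∑ j ∈ s, f j y) = fun y => ∑ j ∈ s, pdl l (f j) y := by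
  induction l with
  | nil => rfl
  | cons i l ih =>
    rw [pdl_cons, ih, pd_sum s fun j hj => differentiable_of_smooth (contDiff_pdl (hf j hj) l)]
    rfl

/-- The pointwise action `∑ i, B^i ∂_i v` of a first order operator on differentiable functions. -/
def FirstOrderOp.onFun (B : FirstOrderOp N) (v : Vec N → Vec N) : Vec N → Mat N :=
  fun y => ∑ i, B i (pd i v y)

lemma contDiff_onFun (B : FirstOrderOp N) {v : Vec N → Vec N} (hv : ContDiff ℝ ∞ v) :
    ContDiff ℝ ∞ (B.onFun v) :=
  ContDiff.sum fun i _ => (B i).contDiff.comp (contDiff_pd hv i)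

/-- Constant coefficients commute with differentiation. With the new index in front, the right side
is the symbol of `B` acting on the tensor of derivatives of `v`. -/
lemma pdl_onFun (B : FirstOrderOp N) {v : Vec N → Vec N} (hv : ContDiff ℝ ∞ v)
    (l : List (Fin N)) (y : Vec N) :
    pdl l (B.onFun v) y = ∑ i, B i (pdl (i :: l) v y) := by
  change pdl l (fun y => ∑ i, B i (pd i v y)) y = _
  rw [pdl_sum (f := fun i y => B i (pd i v y)) _
    fun i _ => (B i).contDiff.comp (contDiff_pd hv i)]
  refine Finset.sum_congr rfl fun i _ => ?_
  rw [pdl_clm_comp (contDiff_pd hv i)]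
  have : pdl l (pd i v) = pdl (i :: l) v := by
    rw [← pdl_perm hv (List.perm_append_singleton i l), pdl_append]
    rfl
  rw [this]

end PartialDerivatives

/-! ### Homogeneous polynomials with vector coefficients -/

section TensorPolynomials

variable {N : ℕ} {F G : Type*} [NormedAddCommGroup F] [NormedSpace ℝ F]
  [NormedAddCommGroup G] [NormedSpace ℝ G]

/-- The polynomial `∑ x_{i₁} ⋯ x_{iₖ} c [i₁, …, iₖ]`, where the sum is over all lists of length
`k`. -/
def tpoly : ℕ → (List (Fin N) → F) → Vec N → F
  | 0, c, _ => c []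
  | k + 1, c, x => ∑ i, x i • tpoly k (fun l => c (i :: l)) x

lemma tpoly_succ (k : ℕ) (c : List (Fin N) → F) (x : Vec N) :
    tpoly (k + 1) c x = ∑ i, x i • tpoly k (fun l => c (i :: l)) x := rfl

lemma tpoly_congr {k : ℕ} {c c' : List (Fin N) → F} (h : ∀ l, l.length = k → c l = c' l)
    (x : Vec N) : tpoly k c x = tpoly k c' x := by
  induction k generalizing c c' with
  | zero => exact h [] rfl
  | succ k ih =>
    exact Finset.sum_congr rfl fun i _ => congrArg _ (ih fun l hl => h _ (by simp [hl]))

lemma tpoly_sum_clm {ι : Type*} (s : Finset ι) (k : ℕ) (L : ι → F →L[ℝ] G)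
    (c : ι → List (Fin N) → F) (x : Vec N) :
    tpoly k (fun l => ∑ j ∈ s, L j (c j l)) x = ∑ j ∈ s, L j (tpoly k (c j) x) := by
  induction k generalizing c with
  | zero => rfl
  | succ k ih =>
    simp only [tpoly_succ, map_sum, map_smul]
    rw [Finset.sum_comm]
    refine Finset.sum_congr rfl fun i _ => ?_
    rw [ih, Finset.smul_sum]

lemma tpoly_zero_coeff (k : ℕ) (x : Vec N) : tpoly k (fun _ => (0 : F)) x = 0 := by
  induction k with
  | zero => rfl
  | succ k ih => simp [tpoly_succ, ih]

lemma tpoly_smul_arg (k : ℕ) (c : List (Fin N) → F) (t : ℝ) (x : Vec N) :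
    tpoly k c (t • x) = t ^ k • tpoly k c x := by
  induction k generalizing c with
  | zero => simp [tpoly]
  | succ k ih =>
    simp only [tpoly_succ, ih, Finset.smul_sum, smul_smul, PiLp.smul_apply, smul_eq_mul]
    exact Finset.sum_congr rfl fun i _ => by ring_nf

lemma contDiff_tpoly (k : ℕ) (c : List (Fin N) → F) : ContDiff ℝ ∞ (tpoly k c) := by
  induction k generalizing c with
  | zero => exact contDiff_const
  | succ k ih =>
    refine ContDiff.sum fun i _ => ContDiff.smul ?_ (ih _)
    exact (EuclideanSpace.proj (𝕜 := ℝ) i).contDiff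

/-- A family of coefficients that is invariant under permutations of the indices. -/
def IsPermInvariant {E : Type*} (c : List (Fin N) → E) : Prop := ∀ l l', l.Perm l' → c l = c l'

lemma IsPermInvariant.cons {E : Type*} {c : List (Fin N) → E} (hc : IsPermInvariant c) (i : Fin N) :
    IsPermInvariant fun l => c (i :: l) := fun _ _ h => hc _ _ (h.cons i)

/-- By the product rule each of the `k + 1` slots may be the one differentiated; permutation
invariance moves that slot to the front, so all contributions agree. -/
lemma pd_tpoly (k : ℕ) {c : List (Fin N) → F} (hc : IsPermInvariant c) (i : Fin N) (x : Vec N) :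
    pd i (tpoly (k + 1) c) x = ((k : ℝ) + 1) • tpoly k (fun l => c (i :: l)) x := by
  induction k generalizing c with
  | zero =>
    have : tpoly 1 c = fun x : Vec N => ∑ j, x j • c [j] := rfl
    rw [this, pd_sum _ fun j _ => by fun_prop]
    have h : ∀ j, pd i (fun x : Vec N => x j • c [j]) x = (e i : Vec N) j • c [j] := by
      intro j
      exact congrArg (fun T => T (e i))
        (((EuclideanSpace.proj (𝕜 := ℝ) j).hasFDerivAt.smul_const (c [j])).fderiv)
    simp only [h]
    simp [e_apply, tpoly]
  | succ k ih =>
    have : tpoly (k + 1 + 1) c =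
        fun x : Vec N => ∑ j, x j • tpoly (k + 1) (fun l => c (j :: l)) x := rfl
    have hd : ∀ j, Differentiable ℝ (tpoly (k + 1) (fun l => c (j :: l))) := fun j =>
      differentiable_of_smooth (contDiff_tpoly _ _)
    rw [this, pd_sum (f := fun j x => x j • tpoly (k + 1) (fun l => c (j :: l)) x) _
      fun j _ => ((EuclideanSpace.proj (𝕜 := ℝ) j).differentiable.smul (hd j))]
    have h : ∀ j, pd i (fun x : Vec N => x j • tpoly (k + 1) (fun l => c (j :: l)) x) x =
        x j • (((k : ℝ) + 1) • tpoly k (fun l => c (i :: j :: l)) x) +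
          (e i : Vec N) j • tpoly (k + 1) (fun l => c (j :: l)) x := by
      intro j
      refine (congrArg (fun T => T (e i))
        (((EuclideanSpace.proj (𝕜 := ℝ) j).hasFDerivAt.smul (hd j x).hasFDerivAt).fderiv)).trans ?_
      change x j • pd i (tpoly (k + 1) (fun l => c (j :: l))) x + _ = _
      rw [ih (hc.cons j)]
      congr 4
      ext1 l
      exact hc _ _ (List.Perm.swap _ _ _)
    simp only [h, Finset.sum_add_distrib]
    have h2 : ∑ j, (e i : Vec N) j • tpoly (k + 1) (fun l => c (j :: l)) x =
        tpoly (k + 1) (fun l => c (i :: l)) x := by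
      simp [e_apply]
    have h1 : ∑ j, x j • (((k : ℝ) + 1) • tpoly k (fun l => c (i :: j :: l)) x) =
        ((k : ℝ) + 1) • tpoly (k + 1) (fun l => c (i :: l)) x := by
      rw [tpoly_succ, Finset.smul_sum]
      exact Finset.sum_congr rfl fun j _ => smul_comm _ _ _
    rw [h1, h2]
    push_cast
    module

/-- Each differentiation peels off one index, up to a nonzero factor. Without symmetry this would
fail, as an antisymmetric `c` gives the zero polynomial. -/
lemma coeff_eq_zero_of_tpoly_eq_zero (k : ℕ) {c : List (Fin N) → F} (hc : IsPermInvariant c)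
    (h : ∀ x, tpoly k c x = 0) (l : List (Fin N)) (hl : l.length = k) : c l = 0 := by
  induction k generalizing c l with
  | zero =>
    rw [List.length_eq_zero_iff] at hl
    rw [hl]
    exact h 0
  | succ k ih =>
    obtain _ | ⟨i, l⟩ := l
    · simp at hl
    refine ih (hc.cons i) (fun x => ?_) l (by simpa using hl)
    have h1 := pd_tpoly k hc i x
    have h2 : tpoly (k + 1) c = fun _ => 0 := funext h
    rw [h2] at h1
    simp only [pd, fderiv_fun_const, Pi.zero_apply, zero_apply] at h1
    exact ((smul_eq_zero.1 h1.symm).resolve_left (by positivity))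

/-- The monomial `x_{i₁} ⋯ x_{iₖ}`. -/
def tmon : List (Fin N) → Vec N → ℝ
  | [], _ => 1
  | i :: l, x => x i * tmon l x

lemma contDiff_tmon (l : List (Fin N)) : ContDiff ℝ ∞ (tmon l) := by
  induction l with
  | nil => exact contDiff_const
  | cons i l ih => exact ((EuclideanSpace.proj (𝕜 := ℝ) i).contDiff).mul ih

lemma tpoly_eq_sum (k : ℕ) (c : List (Fin N) → F) (x : Vec N) :
    tpoly k c x = ∑ ι : Fin k → Fin N, tmon (List.ofFn ι) x • c (List.ofFn ι) := by
  induction k generalizing c with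
  | zero => simp [tpoly, tmon]
  | succ k ih =>
    rw [← (Fin.consEquiv fun _ => Fin N).sum_comp, Fintype.sum_prod_type, tpoly_succ]
    refine Finset.sum_congr rfl fun i _ => ?_
    rw [ih, Finset.smul_sum]
    refine Finset.sum_congr rfl fun ι _ => ?_
    simp [Fin.consEquiv, tmon, mul_smul]

end TensorPolynomials

/-! ### Operators with finite dimensional null-space control all derivatives of high order -/

section NullSpace

variable {N : ℕ}

/-! ### Smooth kernel functions regarded as distributions -/

lemma lineDerivCLM_test_apply {F : Type*} [NormedAddCommGroup F] [NormedSpace ℝ F]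
    {U : Opens (Vec N)} (φ : 𝓓(U, F)) (i : Fin N) (x : Vec N) :
    (TestFunction.lineDerivCLM ℝ (e i) φ : 𝓓(U, F)) x = pd i φ x := by
  rw [TestFunction.lineDerivCLM_apply_of_le (by simp),
    ((φ.contDiff.differentiable (by simp)) x).lineDeriv_eq_fderiv]
  rfl

lemma onDist_toDist_apply (B : FirstOrderOp N) {U : Opens (Vec N)} {u : Vec N → Vec N}
    (hu : LocallyIntegrableOn u U) (φ : 𝓓(U, ℝ)) :
    B.onDist U (toDist U u) φ = -∑ i, B i (∫ x, pd i φ x • u x) := by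
  have h : B.onDist U (toDist U u) φ = ∑ i, B i (Distribution.lineDerivCLM (e i) (toDist U u) φ) := by
    simp only [FirstOrderOp.onDist, sum_apply]
    rfl
  rw [h, ← Finset.sum_neg_distrib]
  refine Finset.sum_congr rfl fun i _ => ?_
  rw [Distribution.lineDerivCLM_apply, toDist_apply hu, map_neg]
  simp only [lineDerivCLM_test_apply]

lemma integral_smul_pd_eq_neg {F : Type*} [NormedAddCommGroup F] [NormedSpace ℝ F]
    {a : Vec N → ℝ} {f : Vec N → F} (ha : ContDiff ℝ ∞ a) (hf : ContDiff ℝ ∞ f)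
    (hc : HasCompactSupport a) (i : Fin N) :
    ∫ x, a x • pd i f x = -∫ x, pd i a x • f x := by
  have hc' : HasCompactSupport (pd i a) := hc.fderiv_apply (𝕜 := ℝ) (e i)
  refine integral_smul_fderiv_eq_neg_fderiv_smul_of_integrable ?_ ?_ ?_
    (fun x _ => differentiable_of_smooth ha x) (fun x _ => differentiable_of_smooth hf x)
  · exact ((contDiff_pd ha i).continuous.smul hf.continuous).integrable_of_hasCompactSupport
      hc'.smul_right
  · exact (ha.continuous.smul (contDiff_pd hf i).continuous).integrable_of_hasCompactSupport
      hc.smul_right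
  · exact (ha.continuous.smul hf.continuous).integrable_of_hasCompactSupport hc.smul_right

lemma toDist_mem_nullSpace (B : FirstOrderOp N) {f : Vec N → Vec N} (hf : ContDiff ℝ ∞ f)
    (h : ∀ x, B.onFun f x = 0) : toDist ⊤ f ∈ B.nullSpace := by
  have hfl := hf.continuous.locallyIntegrable (μ := volume)
  rw [FirstOrderOp.nullSpace, LinearMap.mem_ker]
  refine DFunLike.ext _ _ fun φ => ?_
  refine (onDist_toDist_apply B (hfl.locallyIntegrableOn _) φ).trans ?_
  have h1 : ∀ i, B i (∫ x, pd i φ x • f x) = -∫ x, φ x • B i (pd i f x) := by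
    intro i
    rw [← neg_eq_iff_eq_neg, ← map_neg, ← integral_smul_pd_eq_neg φ.contDiff hf φ.hasCompactSupport,
      ← ContinuousLinearMap.integral_comp_comm]
    · simp
    · exact (φ.continuous.smul (contDiff_pd hf i).continuous).integrable_of_hasCompactSupport
        φ.hasCompactSupport.smul_right
  simp only [h1, Finset.sum_neg_distrib, neg_neg]
  rw [← integral_finsetSum]
  · simp only [← Finset.smul_sum]
    have h2 : ∀ x, ∑ i, B i (pd i f x) = 0 := h
    simp only [h2, smul_zero, integral_zero]
    rfl
  · intro i _
    exact (φ.continuous.smul ((B i).continuous.comp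
      (contDiff_pd hf i).continuous)).integrable_of_hasCompactSupport
        φ.hasCompactSupport.smul_right

lemma eq_zero_of_toDist_eq_zero {f : Vec N → Vec N} (hf : Continuous f)
    (h : toDist ⊤ f = 0) : f = 0 := by
  have hfl := hf.locallyIntegrable (μ := volume)
  have h0 : ∀ᵐ x, f x = 0 := by
    refine ae_eq_zero_of_integral_contDiff_smul_eq_zero hfl fun g hg hgc => ?_
    have := toDist_apply (hfl.locallyIntegrableOn _)
      (⟨g, hg, hgc, by simp⟩ : 𝓓((⊤ : Opens (Vec N)), ℝ))
    rw [h] at this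
    exact this.symm
  exact (hf.ae_eq_iff_eq volume continuous_zero).1 h0

/-- The smooth functions in the kernel of a first order operator. -/
def smoothKernel (B : FirstOrderOp N) : Submodule ℝ (Vec N → Vec N) where
  carrier := {f | ContDiff ℝ ∞ f ∧ ∀ x, B.onFun f x = 0}
  zero_mem' := ⟨contDiff_const, fun x => by simp [FirstOrderOp.onFun, pd]⟩
  add_mem' {f g} hf hg := ⟨hf.1.add hg.1, fun x => by
    have h1 := hf.2 x
    have h2 := hg.2 x
    simp only [FirstOrderOp.onFun, pd] at h1 h2 ⊢
    rw [fderiv_add (differentiable_of_smooth hf.1 x) (differentiable_of_smooth hg.1 x)]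
    simp [Finset.sum_add_distrib, h1, h2]⟩
  smul_mem' c f hf := ⟨contDiff_const.smul hf.1, fun x => by
    have h1 := hf.2 x
    simp only [FirstOrderOp.onFun, pd] at h1 ⊢
    rw [fderiv_const_smul (differentiable_of_smooth hf.1 x)]
    simp [← Finset.smul_sum, h1]⟩

/-- A continuous function is determined by its distribution, so the smooth kernel embeds into the
distributional null-space. -/
lemma finiteDimensional_smoothKernel (B : FirstOrderOp N)
    (h : FiniteDimensional ℝ B.nullSpace) : FiniteDimensional ℝ (smoothKernel B) := by
  have hl : ∀ f : smoothKernel B, LocallyIntegrableOn (f : Vec N → Vec N)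
      ((⊤ : Opens (Vec N)) : Set (Vec N)) := fun f =>
    (f.2.1.continuous.locallyIntegrable (μ := volume)).locallyIntegrableOn _
  let T : smoothKernel B →ₗ[ℝ] B.nullSpace :=
    { toFun := fun f => ⟨toDist ⊤ f, toDist_mem_nullSpace B f.2.1 f.2.2⟩
      map_add' := fun f g => Subtype.ext (toDist_add (hl f) (hl g))
      map_smul' := fun c f => Subtype.ext (toDist_smul (hl f) c) }
  refine FiniteDimensional.of_injective T ?_
  rw [← LinearMap.ker_eq_bot, LinearMap.ker_eq_bot']
  intro f hf
  exact Subtype.ext (eq_zero_of_toDist_eq_zero f.2.1.continuous (congrArg Subtype.val hf))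

/-- Applying `B` to the polynomial gives `m + 1` times the polynomial of degree `m` whose
coefficients are the symbol of `B` applied to `c`. -/
lemma tpoly_mem_smoothKernel (B : FirstOrderOp N) (m : ℕ) {c : List (Fin N) → Vec N}
    (hc : IsPermInvariant c) (h : ∀ l, l.length = m → ∑ i, B i (c (i :: l)) = 0) :
    tpoly (m + 1) c ∈ smoothKernel B := by
  refine ⟨contDiff_tpoly _ _, fun x => ?_⟩
  simp only [FirstOrderOp.onFun, pd_tpoly m hc, map_smul]
  rw [← Finset.smul_sum, ← tpoly_sum_clm Finset.univ m (fun i => B i) (fun i l => c (i :: l)),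
    tpoly_congr h, tpoly_zero_coeff, smul_zero]

/-- If the null-space of `B` is finite dimensional, then there is a degree in which the symbol of
`B` is injective on symmetric tensors. -/
lemma exists_symbol_injective (B : FirstOrderOp N) (h : FiniteDimensional ℝ B.nullSpace) :
    ∃ m : ℕ, ∀ c : List (Fin N) → Vec N, IsPermInvariant c →
      (∀ l, l.length = m → ∑ i, B i (c (i :: l)) = 0) → ∀ l, l.length = m + 1 → c l = 0 := by
  by_contra! hcon
  choose c hc hB l hl hne using hcon
  have := finiteDimensional_smoothKernel B h
  let p : ℕ → smoothKernel B := fun m =>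
    ⟨tpoly (m + 1) (c m), tpoly_mem_smoothKernel B m (hc m) (hB m)⟩
  -- Dilation by 2 has a homogeneous polynomial of degree `m + 1` as eigenvector with eigenvalue `2
  -- ^ (m + 1)`. Distinct eigenvalues give an infinite independent family in a finite dimensional
  -- space.
  let D : Module.End ℝ (Vec N → Vec N) := LinearMap.funLeft ℝ (Vec N) fun x => (2 : ℝ) • x
  have hp : LinearIndependent ℝ fun m => (p m : Vec N → Vec N) := by
    refine Module.End.eigenvectors_linearIndependent' D (fun m : ℕ => (2 : ℝ) ^ (m + 1)) ?_ _ ?_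
    · intro a b hab
      simpa using pow_right_injective₀ (by norm_num : (0 : ℝ) < 2) (by norm_num) hab
    · intro m
      refine ⟨Module.End.mem_eigenspace_iff.2 (funext fun x => ?_), fun h0 => hne m ?_⟩
      · exact tpoly_smul_arg _ _ _ _
      · exact coeff_eq_zero_of_tpoly_eq_zero (m + 1) (hc m) (fun x => congrFun h0 x) _ (hl m)
  have hp' : LinearIndependent ℝ p := LinearIndependent.of_comp (smoothKernel B).subtype hp
  have := hp'.finite
  exact not_finite ℕ

/-- On the range of `g`, take `f` after a linear section of `g`; the kernel inclusion makes the
choice of preimage irrelevant. Then extend to all of `W₂`. -/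
lemma exists_comp_eq_of_ker_le_ker {K V W₁ W₂ : Type*} [Field K] [AddCommGroup V] [Module K V]
    [AddCommGroup W₁] [Module K W₁] [AddCommGroup W₂] [Module K W₂] (f : V →ₗ[K] W₁)
    (g : V →ₗ[K] W₂) (h : g.ker ≤ f.ker) : ∃ L : W₂ →ₗ[K] W₁, ∀ x, f x = L (g x) := by
  obtain ⟨s, hs⟩ := g.rangeRestrict.exists_rightInverse_of_surjective g.range_rangeRestrict
  obtain ⟨L, hL⟩ := (f.comp s).exists_extend
  refine ⟨L, fun x => ?_⟩
  have h1 : L (g x) = f (s (g.rangeRestrict x)) := LinearMap.congr_fun hL (g.rangeRestrict x)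
  rw [h1, ← sub_eq_zero, ← map_sub, ← LinearMap.mem_ker]
  apply h
  rw [LinearMap.mem_ker, map_sub, sub_eq_zero]
  exact (congrArg Subtype.val (LinearMap.congr_fun hs (g.rangeRestrict x))).symm

/-- If the null-space of `B` is finite dimensional, then symmetric tensors of some degree can be
recovered linearly from their image under the symbol of `B`. -/
lemma exists_symbol_leftInverse (B : FirstOrderOp N) (h : FiniteDimensional ℝ B.nullSpace) :
    ∃ (m : ℕ) (L : (Fin (m + 1) → Fin N) → (Fin m → Fin N) → (Mat N →L[ℝ] Vec N)),
      ∀ c : List (Fin N) → Vec N, IsPermInvariant c → ∀ ι,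
        c (List.ofFn ι) = ∑ κ, L ι κ (∑ i, B i (c (i :: List.ofFn κ))) := by
  obtain ⟨m, hm⟩ := exists_symbol_injective B h
  let V : Submodule ℝ (List (Fin N) → Vec N) :=
    { carrier := {c | IsPermInvariant c}
      zero_mem' := fun _ _ _ => rfl
      add_mem' := fun ha hb l l' h => by simp only [Pi.add_apply, ha l l' h, hb l l' h]
      smul_mem' := fun a c hc l l' h => by simp only [Pi.smul_apply, hc l l' h] }
  let f : V →ₗ[ℝ] ((Fin (m + 1) → Fin N) → Vec N) :=
    { toFun := fun c ι => (c : List (Fin N) → Vec N) (List.ofFn ι)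
      map_add' := fun _ _ => rfl
      map_smul' := fun _ _ => rfl }
  let g : V →ₗ[ℝ] ((Fin m → Fin N) → Mat N) :=
    { toFun := fun c κ => ∑ i, B i ((c : List (Fin N) → Vec N) (i :: List.ofFn κ))
      map_add' := fun a b => by ext1 κ; simp [Finset.sum_add_distrib]
      map_smul' := fun a c => by ext1 κ; simp [Finset.smul_sum] }
  -- Injectivity of the symbol is exactly the kernel inclusion. `V` may be infinite dimensional: `f`
  -- and `g` only read coefficients on lists of length `m + 1`.
  obtain ⟨L, hL⟩ := exists_comp_eq_of_ker_le_ker f g (fun c hc => by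
    rw [LinearMap.mem_ker] at hc ⊢
    ext1 ι
    refine hm c c.2 (fun l hl => ?_) _ (by simp)
    subst hl
    have := congrFun hc l.get
    simpa [g] using this)
  refine ⟨m, fun ι κ => LinearMap.toContinuousLinearMap
    ((LinearMap.proj ι).comp (L.comp (LinearMap.single ℝ _ κ))), fun c hc ι => ?_⟩
  refine (congrFun (hL ⟨c, hc⟩) ι).trans ?_
  conv_lhs => rw [← Finset.univ_sum_single (g ⟨c, hc⟩)]
  rw [map_sum, Finset.sum_apply]
  rfl

end NullSpace

/-! ### An averaged Taylor formula -/

section Representation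

variable {N : ℕ} {F : Type*} [NormedAddCommGroup F] [NormedSpace ℝ F]

lemma tsupport_pdl_subset (l : List (Fin N)) (f : Vec N → F) :
    tsupport (pdl l f) ⊆ tsupport f := by
  induction l with
  | nil => exact subset_rfl
  | cons i l ih => exact (tsupport_fderiv_apply_subset ℝ (e i)).trans ih

/-- Joint regularity in the parameter makes the Taylor kernels continuous in both variables. -/
lemma contDiff_pdl_param {a : Vec N → Vec N → F} (ha : ContDiff ℝ ∞ (Function.uncurry a))
    (l : List (Fin N)) : ContDiff ℝ ∞ (Function.uncurry fun x => pdl l (a x)) := by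
  induction l with
  | nil => exact ha
  | cons i l ih =>
    have h : ContDiff ℝ ∞ (Function.uncurry fun (p : Vec N × Vec N) z => pdl l (a p.1) z) := by
      exact ih.comp (contDiff_fst.fst.prodMk contDiff_snd)
    exact (ContDiff.fderiv h contDiff_snd (by simp)).clm_apply contDiff_const

lemma pd_comp_homothety {f : Vec N → F} (hf : ContDiff ℝ ∞ f) (x : Vec N) (s : ℝ) (i : Fin N)
    (z : Vec N) :
    pd i (fun z => f (x + s • (z - x))) z = s • pd i f (x + s • (z - x)) := by
  have h1 : HasFDerivAt (fun z : Vec N => x + s • (z - x)) (s • ContinuousLinearMap.id ℝ (Vec N)) z :=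
    (((hasFDerivAt_id z).sub_const x).const_smul s).const_add x
  have h2 := (differentiable_of_smooth hf (x + s • (z - x))).hasFDerivAt.comp z h1
  change fderiv ℝ (f ∘ fun z => x + s • (z - x)) z (e i) = _
  rw [h2.fderiv]
  simp [pd]

lemma contDiff_comp_homothety {f : Vec N → F} (hf : ContDiff ℝ ∞ f) (x : Vec N) (s : ℝ) :
    ContDiff ℝ ∞ fun z => f (x + s • (z - x)) :=
  hf.comp (by fun_prop)

/-- Iterated integration by parts along a homothety with centre `x` and ratio `s`. -/
lemma pow_smul_integral_pdl_homothety {a : Vec N → ℝ} {f : Vec N → F} (ha : ContDiff ℝ ∞ a)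
    (hc : HasCompactSupport a) (hf : ContDiff ℝ ∞ f) (x : Vec N) (s : ℝ) (l : List (Fin N)) :
    s ^ l.length • ∫ z, a z • pdl l f (x + s • (z - x)) =
      (-1 : ℝ) ^ l.length • ∫ z, pdl l.reverse a z • f (x + s • (z - x)) := by
  induction l generalizing a with
  | nil => simp
  | cons i l ih =>
    have hl := contDiff_pdl hf l
    -- The chain rule turns `s` times `∂_i` of the function at the moved point into `∂_i` of the
    -- composition. Nothing is divided by `s`, so `s = 0` is allowed. The outermost derivative moves
    -- first, whence the reversed list.
    have h := integral_smul_pd_eq_neg ha (contDiff_comp_homothety hl x s) hc i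
    simp only [pd_comp_homothety hl, smul_comm _ s] at h
    rw [integral_smul] at h
    rw [List.length_cons, pow_succ, mul_smul, pdl_cons, h, smul_neg,
      ih (contDiff_pd ha i) (hc.fderiv_apply (𝕜 := ℝ) (e i)), List.reverse_cons, pow_succ,
      mul_neg_one, neg_smul]
    simp only [pdl_append, pdl_cons, pdl_nil]

/-! ### Taylor's formula along a segment -/

lemma hasDerivAt_tpoly_pdl {v : Vec N → F} (hv : ContDiff ℝ ∞ v) (x h : Vec N) (j : ℕ) (s : ℝ) :
    HasDerivAt (fun s : ℝ => tpoly j (fun l => pdl l v (x + s • h)) h)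
      (tpoly (j + 1) (fun l => pdl l v (x + s • h)) h) s := by
  have h1 : ∀ l, HasDerivAt (fun s : ℝ => pdl l v (x + s • h))
      (∑ i, h i • pdl (i :: l) v (x + s • h)) s := by
    intro l
    have h2 : HasDerivAt (fun s : ℝ => x + s • h) h s := by
      simpa using ((hasDerivAt_id s).smul_const h).const_add x
    have h3 := (differentiable_of_smooth (contDiff_pdl hv l) (x + s • h)).hasFDerivAt.comp_hasDerivAt
      s h2
    rwa [fderiv_eq_sum_pd] at h3
  simp only [tpoly_succ, tpoly_eq_sum]
  have h4 := HasDerivAt.fun_sum (u := Finset.univ) fun (ι : Fin j → Fin N) _ =>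
    (h1 (List.ofFn ι)).const_smul (tmon (List.ofFn ι) h)
  refine h4.congr_deriv ?_
  simp only [Finset.smul_sum]
  rw [Finset.sum_comm]
  refine Finset.sum_congr rfl fun _ _ => Finset.sum_congr rfl fun _ _ => smul_comm _ _ _

/-- The product rule gives a telescoping sum, of which only the top term survives. -/
lemma hasDerivAt_taylor_sum {G : ℕ → ℝ → F} {s : ℝ} (m : ℕ)
    (hG : ∀ j, HasDerivAt (G j) (G (j + 1) s) s) :
    HasDerivAt (fun s => ∑ j ∈ Finset.range (m + 1), ((-s) ^ j / (j.factorial : ℝ)) • G j s)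
      (((-s) ^ m / (m.factorial : ℝ)) • G (m + 1) s) s := by
  induction m with
  | zero => simpa using hG 0
  | succ m ih =>
    simp only [Finset.sum_range_succ _ (m + 1)]
    have h1 : HasDerivAt (fun s : ℝ => (-s) ^ (m + 1) / ((m + 1).factorial : ℝ))
        (-((-s) ^ m / (m.factorial : ℝ))) s := by
      have h2 := ((hasDerivAt_neg s).pow (m + 1)).div_const ((m + 1).factorial : ℝ)
      refine h2.congr_deriv ?_
      have : (m.factorial : ℝ) ≠ 0 := by positivity
      have h3 : (m : ℝ) + 1 ≠ 0 := by positivity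
      simp only [Nat.factorial_succ, Nat.cast_mul, Nat.cast_add, Nat.cast_one,
        Nat.add_sub_cancel]
      field_simp
    refine (ih.add (h1.smul (hG (m + 1)))).congr_deriv ?_
    module

/-- The expansion point is `t` and the evaluation point is `0`. The remainder therefore carries
`(-s) ^ m`, the power needed for the integrations by parts at scale `s`. -/
lemma taylor_sum_sub {G : ℕ → ℝ → F} [CompleteSpace F] (m : ℕ)
    (hG : ∀ j s, HasDerivAt (G j) (G (j + 1) s) s) (t : ℝ) :
    G 0 0 = ∑ j ∈ Finset.range (m + 1), ((-t) ^ j / (j.factorial : ℝ)) • G j t -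
      ∫ s in (0 : ℝ)..t, ((-s) ^ m / (m.factorial : ℝ)) • G (m + 1) s := by
  have hc : ∀ j, Continuous (G j) := fun j =>
    continuous_iff_continuousAt.2 fun s => (hG j s).continuousAt
  rw [intervalIntegral.integral_eq_sub_of_hasDerivAt
    (fun s _ => hasDerivAt_taylor_sum m fun j => hG j s)
    (Continuous.intervalIntegrable (by have := hc (m + 1); fun_prop) _ _)]
  simp [Finset.sum_range_succ']

lemma integrable_prod_of_continuous {F X : Type*} [NormedAddCommGroup F] [TopologicalSpace X] [MeasurableSpace X]
    [OpensMeasurableSpace X] [SecondCountableTopology X] [T2Space X] {μ : Measure X}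
    [IsFiniteMeasureOnCompacts μ] [SFinite μ] {f : ℝ → X → F}
    (hf : Continuous (Function.uncurry f)) {K : Set X} (hK : IsCompact K)
    (h0 : ∀ s, ∀ z ∉ K, f s z = 0) (a b : ℝ) :
    Integrable (Function.uncurry f) ((volume.restrict (Set.uIoc a b)).prod μ) := by
  have h1 : (volume.restrict (Set.uIoc a b)).prod μ =
      (volume.prod μ).restrict (Set.uIoc a b ×ˢ (univ : Set X)) := by
    rw [← Measure.prod_restrict, Measure.restrict_univ]
  rw [h1]
  change IntegrableOn _ _ _
  have h2 : IntegrableOn (Function.uncurry f) (Set.uIcc a b ×ˢ K) (volume.prod μ) :=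
    hf.continuousOn.integrableOn_compact (isCompact_uIcc.prod hK)
  refine (h2.mono_set (s := Set.uIoc a b ×ˢ K)
    (prod_mono uIoc_subset_uIcc subset_rfl)).of_forall_sdiff_eq_zero
    (measurableSet_uIoc.prod MeasurableSet.univ) ?_
  rintro ⟨s, z⟩ ⟨⟨hs, _⟩, hz⟩
  exact h0 s z fun hzK => hz ⟨hs, hzK⟩

/-! ### The averaging weight and the kernels -/

/-- The fixed averaging weight, a smooth probability density supported in a ball inside the
unit cube. -/
def weightBump (N : ℕ) : ContDiffBump (0 : Vec N) where
  rIn := 1 / 8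
  rOut := 1 / 4
  rIn_pos := by norm_num
  rIn_lt_rOut := by norm_num

/-- The weight times a monomial in `z - x`. -/
def momentWeight (l : List (Fin N)) (x z : Vec N) : ℝ :=
  (weightBump N).normed volume z * tmon l (z - x)

lemma contDiff_momentWeight (l : List (Fin N)) :
    ContDiff ℝ ∞ (Function.uncurry (momentWeight l)) :=
  ((weightBump N).contDiff_normed.comp contDiff_snd).mul
    ((contDiff_tmon l).comp (contDiff_snd.sub contDiff_fst))

lemma contDiff_momentWeight_right (l : List (Fin N)) (x : Vec N) :
    ContDiff ℝ ∞ (momentWeight l x) :=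
  (contDiff_momentWeight l).comp (contDiff_prodMk_right x)

lemma tsupport_momentWeight_subset (l : List (Fin N)) (x : Vec N) :
    tsupport (momentWeight l x) ⊆ Metric.closedBall 0 (1 / 4) :=
  (closure_mono (Function.support_mul_subset_left _ _)).trans
    ((weightBump N).tsupport_normed_eq (μ := volume)).le

lemma hasCompactSupport_momentWeight (l : List (Fin N)) (x : Vec N) :
    HasCompactSupport (momentWeight l x) :=
  (isCompact_closedBall _ _).of_isClosed_subset (isClosed_tsupport _)
    (tsupport_momentWeight_subset l x)

lemma integral_weight_smul_tpoly {v : Vec N → F} (hv : ContDiff ℝ ∞ v) (x : Vec N) (s : ℝ)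
    (j : ℕ) :
    ∫ z, (weightBump N).normed volume z • tpoly j (fun l => pdl l v (x + s • (z - x))) (z - x) =
      ∑ ι : Fin j → Fin N,
        ∫ z, momentWeight (List.ofFn ι) x z • pdl (List.ofFn ι) v (x + s • (z - x)) := by
  rw [← integral_finsetSum]
  · simp only [tpoly_eq_sum, Finset.smul_sum, momentWeight, mul_smul]
  · intro ι _
    exact ((contDiff_momentWeight_right _ x).continuous.smul
      (contDiff_comp_homothety (contDiff_pdl hv _) x s).continuous).integrable_of_hasCompactSupport
        (hasCompactSupport_momentWeight _ x).smul_right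

/-- The kernel of the averaged Taylor polynomial of order `m`. -/
def taylorKernel (m : ℕ) (x z : Vec N) : ℝ :=
  ∑ j ∈ Finset.range (m + 1), (j.factorial : ℝ)⁻¹ *
    ∑ ι : Fin j → Fin N, pdl (List.ofFn ι).reverse (momentWeight (List.ofFn ι) x) z

/-- The kernel of the remainder in the averaged Taylor formula of order `m`. -/
def remainderKernel {m : ℕ} (L : (Fin (m + 1) → Fin N) → (Fin m → Fin N) → (Mat N →L[ℝ] Vec N))
    (x z : Vec N) : Mat N →L[ℝ] Vec N :=
  (m.factorial : ℝ)⁻¹ •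
    ∑ ι, ∑ κ, pdl (List.ofFn κ).reverse (momentWeight (List.ofFn ι) x) z • (-L ι κ)

lemma continuous_pdl_momentWeight (l l' : List (Fin N)) :
    Continuous (Function.uncurry fun x => pdl l (momentWeight l' x)) :=
  (contDiff_pdl_param (contDiff_momentWeight l') l).continuous

lemma pdl_momentWeight_eq_zero (l l' : List (Fin N)) (x : Vec N) {z : Vec N}
    (hz : z ∉ Metric.closedBall (0 : Vec N) (1 / 4)) : pdl l (momentWeight l' x) z = 0 :=
  image_eq_zero_of_notMem_tsupport fun h =>
    hz (tsupport_momentWeight_subset l' x (tsupport_pdl_subset l _ h))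

lemma integrable_pdl_momentWeight_smul (l l' : List (Fin N)) (x : Vec N) {f : Vec N → F}
    (hf : Continuous f) : Integrable fun z => pdl l (momentWeight l' x) z • f z := by
  refine ((contDiff_pdl (contDiff_momentWeight_right l' x) l).continuous.smul
    hf).integrable_of_hasCompactSupport (HasCompactSupport.smul_right ?_)
  exact HasCompactSupport.of_support_subset_isCompact (isCompact_closedBall 0 (1 / 4)) fun z hz => by
    by_contra h
    exact hz (pdl_momentWeight_eq_zero l l' x h)

lemma continuous_taylorKernel (m : ℕ) : Continuous (Function.uncurry (taylorKernel (N := N) m)) := by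
  simp only [Function.uncurry_def, taylorKernel]
  exact continuous_finsetSum _ fun j _ => continuous_const.fun_mul <|
    continuous_finsetSum Finset.univ fun (ι : Fin j → Fin N) _ =>
      continuous_pdl_momentWeight (List.ofFn ι).reverse (List.ofFn ι)

lemma taylorKernel_eq_zero (m : ℕ) (x : Vec N) {z : Vec N}
    (hz : z ∉ Metric.closedBall (0 : Vec N) (1 / 4)) : taylorKernel m x z = 0 := by
  simp only [taylorKernel, pdl_momentWeight_eq_zero _ _ x hz, Finset.sum_const_zero, mul_zero]

lemma continuous_remainderKernel {m : ℕ}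
    (L : (Fin (m + 1) → Fin N) → (Fin m → Fin N) → (Mat N →L[ℝ] Vec N)) :
    Continuous (Function.uncurry (remainderKernel L)) :=
  continuous_const.fun_smul <| continuous_finsetSum _ fun _ _ => continuous_finsetSum _ fun _ _ =>
    (continuous_pdl_momentWeight _ _).fun_smul continuous_const

lemma remainderKernel_eq_zero {m : ℕ}
    (L : (Fin (m + 1) → Fin N) → (Fin m → Fin N) → (Mat N →L[ℝ] Vec N)) (x : Vec N) {z : Vec N}
    (hz : z ∉ Metric.closedBall (0 : Vec N) (1 / 4)) : remainderKernel L x z = 0 := by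
  refine smul_eq_zero_of_right (m.factorial : ℝ)⁻¹ (Finset.sum_eq_zero fun ι _ => Finset.sum_eq_zero fun κ _ => ?_)
  rw [pdl_momentWeight_eq_zero _ _ x hz]
  exact zero_smul ℝ (-L ι κ)

/-- In the term of order `j`, the factor `t ^ j` is used up by `j` integrations by parts and the two
signs `(-1) ^ j` cancel. Hence the kernel does not depend on `t`. -/
lemma integral_weight_smul_taylor_sum {v : Vec N → F} (hv : ContDiff ℝ ∞ v) (m : ℕ) (x : Vec N)
    (t : ℝ) :
    ∫ z, (weightBump N).normed volume z • ∑ j ∈ Finset.range (m + 1),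
        ((-t) ^ j / (j.factorial : ℝ)) • tpoly j (fun l => pdl l v (x + t • (z - x))) (z - x) =
      ∫ z, taylorKernel m x z • v (x + t • (z - x)) := by
  have hcv := (contDiff_comp_homothety hv x t).continuous
  simp only [taylorKernel, Finset.sum_smul, mul_smul, Finset.smul_sum]
  rw [integral_finsetSum, integral_finsetSum]
  · refine Finset.sum_congr rfl fun j _ => ?_
    rw [integral_finsetSum _ fun ι _ => (integrable_pdl_momentWeight_smul (List.ofFn ι).reverse
      (List.ofFn ι) x hcv).fun_smul _]
    simp only [smul_comm _ ((-t) ^ j / (j.factorial : ℝ)), integral_smul,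
      integral_weight_smul_tpoly hv]
    rw [Finset.smul_sum]
    refine Finset.sum_congr rfl fun ι _ => ?_
    have h := pow_smul_integral_pdl_homothety (contDiff_momentWeight_right (List.ofFn ι) x)
      (hasCompactSupport_momentWeight _ x) hv x t (List.ofFn ι)
    rw [List.length_ofFn] at h
    have h1 : (-t) ^ j / (j.factorial : ℝ) = (j.factorial : ℝ)⁻¹ * (-1) ^ j * t ^ j := by
      rw [neg_pow]; ring
    have h2 : (j.factorial : ℝ)⁻¹ * (-1) ^ j * (-1) ^ j = (j.factorial : ℝ)⁻¹ := by
      rw [mul_assoc, ← mul_pow]; simp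
    rw [h1, mul_smul, h, smul_smul, h2]
  · intro j _
    exact integrable_finsetSum _ fun ι _ =>
      (integrable_pdl_momentWeight_smul _ _ x hcv).smul _
  · intro j _
    simp only [smul_comm _ ((-t) ^ j / (j.factorial : ℝ)), tpoly_eq_sum, Finset.smul_sum]
    refine integrable_finsetSum _ fun ι _ => Integrable.smul _ ?_
    simpa only [momentWeight, mul_smul, pdl_nil] using
      integrable_pdl_momentWeight_smul [] (List.ofFn ι) x
      (contDiff_comp_homothety (contDiff_pdl hv (List.ofFn ι)) x t).continuous

/-- Derivatives of `v` of order `m + 1` become derivatives of `B v` of order `m`, and the `m`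
integrations by parts consume exactly `s ^ m`. So `B v` appears undifferentiated, against a kernel
that does not blow up as `s → 0`. -/
lemma smul_integral_weight_tpoly_eq {B : FirstOrderOp N} {m : ℕ}
    {L : (Fin (m + 1) → Fin N) → (Fin m → Fin N) → (Mat N →L[ℝ] Vec N)}
    (hL : ∀ c : List (Fin N) → Vec N, IsPermInvariant c → ∀ ι,
        c (List.ofFn ι) = ∑ κ, L ι κ (∑ i, B i (c (i :: List.ofFn κ))))
    {v : Vec N → Vec N} (hv : ContDiff ℝ ∞ v) (x : Vec N) (s : ℝ) :
    ((-s) ^ m / (m.factorial : ℝ)) • ∫ z, (weightBump N).normed volume z •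
        tpoly (m + 1) (fun l => pdl l v (x + s • (z - x))) (z - x) =
      -∫ z, remainderKernel L x z (B.onFun v (x + s • (z - x))) := by
  have hBv := contDiff_onFun B hv
  have hcv := (contDiff_comp_homothety hBv x s).continuous
  have key : ∀ (ι : Fin (m + 1) → Fin N) (y : Vec N), pdl (List.ofFn ι) v y =
      ∑ κ, L ι κ (pdl (List.ofFn κ) (B.onFun v) y) := by
    intro ι y
    rw [hL (fun l => pdl l v y) (fun l l' h => congrFun (pdl_perm hv h) y) ι]
    simp only [pdl_onFun B hv]
  have hI : ∀ ι κ, Integrable fun z => momentWeight (List.ofFn ι) x z •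
      pdl (List.ofFn (κ : Fin m → Fin N)) (B.onFun v) (x + s • (z - x)) := fun ι κ =>
    integrable_pdl_momentWeight_smul [] (List.ofFn (ι : Fin (m + 1) → Fin N)) x
      (contDiff_comp_homothety (contDiff_pdl hBv _) x s).continuous
  have h1 : ∀ ι : Fin (m + 1) → Fin N,
      ∫ z, momentWeight (List.ofFn ι) x z • pdl (List.ofFn ι) v (x + s • (z - x)) =
        ∑ κ, L ι κ (∫ z, momentWeight (List.ofFn ι) x z •
          pdl (List.ofFn κ) (B.onFun v) (x + s • (z - x))) := by
    intro ι
    simp only [key, Finset.smul_sum]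
    rw [integral_finsetSum]
    · refine Finset.sum_congr rfl fun κ _ => ?_
      rw [← ContinuousLinearMap.integral_comp_comm _ (hI ι κ)]
      simp only [map_smul]
    · intro κ _
      simpa only [map_smul] using (L ι κ).integrable_comp (hI ι κ)
  have h2 : ∀ ι κ, s ^ m • ∫ z, momentWeight (List.ofFn (ι : Fin (m + 1) → Fin N)) x z •
        pdl (List.ofFn (κ : Fin m → Fin N)) (B.onFun v) (x + s • (z - x)) =
      (-1 : ℝ) ^ m • ∫ z, pdl (List.ofFn κ).reverse (momentWeight (List.ofFn ι) x) z •
        B.onFun v (x + s • (z - x)) := by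
    intro ι κ
    have h := pow_smul_integral_pdl_homothety (contDiff_momentWeight_right (List.ofFn ι) x)
      (hasCompactSupport_momentWeight _ x) hBv x s (List.ofFn κ)
    rwa [List.length_ofFn] at h
  have h3 : (-s) ^ m / (m.factorial : ℝ) = (m.factorial : ℝ)⁻¹ * (-1) ^ m * s ^ m := by
    rw [neg_pow]; ring
  have h4 : (m.factorial : ℝ)⁻¹ * (-1) ^ m * (-1) ^ m = (m.factorial : ℝ)⁻¹ := by
    rw [mul_assoc, ← mul_pow]; simp
  have hJ : ∀ ι κ, Integrable fun z =>
      pdl (List.ofFn (κ : Fin m → Fin N)).reverse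
        (momentWeight (List.ofFn (ι : Fin (m + 1) → Fin N)) x) z •
        B.onFun v (x + s • (z - x)) := fun ι κ => integrable_pdl_momentWeight_smul _ _ x hcv
  rw [integral_weight_smul_tpoly hv, h3, mul_smul]
  simp only [h1, Finset.smul_sum]
  simp only [← map_smul, h2]
  simp only [map_smul, ← Finset.smul_sum]
  rw [smul_smul, h4, ← integral_neg]
  simp only [remainderKernel, smul_apply, sum_apply, neg_apply, smul_neg, Finset.sum_neg_distrib,
    neg_neg]
  rw [integral_smul, integral_finsetSum]
  · congr 1
    refine Finset.sum_congr rfl fun ι _ => ?_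
    rw [integral_finsetSum]
    · refine Finset.sum_congr rfl fun κ _ => ?_
      rw [← ContinuousLinearMap.integral_comp_comm _ (hJ ι κ)]
      simp only [map_smul]
    · intro κ _
      simpa only [map_smul] using (L ι κ).integrable_comp (hJ ι κ)
  · intro ι _
    refine integrable_finsetSum _ fun κ _ => ?_
    simpa only [map_smul] using (L ι κ).integrable_comp (hJ ι κ)

/-- The averaged Taylor formula, with a remainder in terms of `B v`. -/
lemma averaged_taylor {B : FirstOrderOp N} {m : ℕ}
    {L : (Fin (m + 1) → Fin N) → (Fin m → Fin N) → (Mat N →L[ℝ] Vec N)}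
    (hL : ∀ c : List (Fin N) → Vec N, IsPermInvariant c → ∀ ι,
        c (List.ofFn ι) = ∑ κ, L ι κ (∑ i, B i (c (i :: List.ofFn κ))))
    {v : Vec N → Vec N} (hv : ContDiff ℝ ∞ v) (x : Vec N) (t : ℝ) :
    v x = (∫ z, taylorKernel m x z • v (x + t • (z - x))) +
      ∫ s in (0 : ℝ)..t, ∫ z, remainderKernel L x z (B.onFun v (x + s • (z - x))) := by
  let w : Vec N → ℝ := (weightBump N).normed volume
  let G : Vec N → ℕ → ℝ → Vec N := fun z j s =>
    tpoly j (fun l => pdl l v (x + s • (z - x))) (z - x)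
  have hwc : Continuous w := (weightBump N).continuous_normed
  have hGc : ∀ j, Continuous (Function.uncurry fun s z => G z j s) := by
    intro j
    simp only [G, tpoly_eq_sum]
    refine continuous_finsetSum _ fun ι _ => Continuous.fun_smul ?_ ?_
    · exact (contDiff_tmon _).continuous.comp (by fun_prop)
    · exact (contDiff_pdl hv _).continuous.comp (by fun_prop)
  have hw0 : ∀ z ∉ Metric.closedBall (0 : Vec N) (1 / 4), w z = 0 := fun z hz =>
    image_eq_zero_of_notMem_tsupport fun h => hz (((weightBump N).tsupport_normed_eq (μ := volume)).le h)
  -- Taylor's formula on the segment from `x` towards `z`; since `w` has integral one, integrating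
  -- over `z` recovers `v x`.
  have h1 : ∀ z, w z • v x = w z • ∑ j ∈ Finset.range (m + 1),
      ((-t) ^ j / (j.factorial : ℝ)) • G z j t -
      ∫ s in (0 : ℝ)..t, w z • (((-s) ^ m / (m.factorial : ℝ)) • G z (m + 1) s) := by
    intro z
    rw [intervalIntegral.integral_smul, ← smul_sub,
      ← taylor_sum_sub (G := G z) m (fun j s => hasDerivAt_tpoly_pdl hv x (z - x) j s) t]
    simp [G, tpoly]
  have hw_comp : HasCompactSupport w := (weightBump N).hasCompactSupport_normed
  have hfub := integrable_prod_of_continuous (μ := (volume : Measure (Vec N)))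
    (f := fun s z => w z • (((-s) ^ m / (m.factorial : ℝ)) • G z (m + 1) s))
    (by
      refine (hwc.comp continuous_snd).fun_smul (Continuous.fun_smul ?_ (hGc (m + 1)))
      exact ((continuous_fst.neg).pow m).div_const _) (isCompact_closedBall (0 : Vec N) (1 / 4))
    (fun s z hz => by simp only [hw0 z hz, zero_smul]) 0 t
  have h2 : v x = ∫ z, w z • v x := by
    rw [integral_smul_const, (weightBump N).integral_normed, one_smul]
  rw [h2]
  simp only [h1]
  rw [integral_sub, ← intervalIntegral_integral_swap hfub, integral_weight_smul_taylor_sum hv,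
    sub_eq_add_neg, ← intervalIntegral.integral_neg]
  · refine congrArg _ (congrArg (fun f : ℝ → Vec N => ∫ s in (0 : ℝ)..t, f s) (funext fun s => ?_))
    simp only [smul_comm (w _), integral_smul]
    exact (congrArg Neg.neg (smul_integral_weight_tpoly_eq hL hv x s)).trans (neg_neg _)
  · refine Continuous.integrable_of_hasCompactSupport (hwc.fun_smul ?_) hw_comp.smul_right
    exact continuous_finsetSum _ fun j _ => continuous_const.fun_smul
      ((hGc j).comp (continuous_const.prodMk continuous_id))
  · simp only [intervalIntegral.intervalIntegral_eq_integral_uIoc]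
    exact hfub.integral_prod_right.fun_smul _

end Representation

/-! ### The error of the averaged Taylor polynomial -/

section Estimate

variable {N : ℕ}

/-- Substitute `y = (1 - s) x + s z`: convexity keeps `y` in `S`, and the Jacobian factor `(1 -
s)⁻ᴺ` is at most `2 ^ N` because `s ≤ 1/2`. -/
lemma lintegral_homothety_le {φ : Vec N → ℝ≥0∞} (hφ : Measurable φ) {S : Set (Vec N)}
    (hS : MeasurableSet S) (hconv : Convex ℝ S) {z : Vec N} (hz : z ∈ S) {s : ℝ} (h0 : 0 ≤ s)
    (h1 : s ≤ 1 / 2) :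
    ∫⁻ x in S, φ (x + s • (z - x)) ≤ 2 ^ N * ∫⁻ x in S, φ x := by
  have hs : (0 : ℝ) < 1 - s := by linarith
  have hm : Measurable fun y : Vec N => S.indicator φ (y + s • z) :=
    (hφ.indicator hS).comp (measurable_id.add_const _)
  calc ∫⁻ x in S, φ (x + s • (z - x)) ≤ ∫⁻ x in S, S.indicator φ ((1 - s) • x + s • z) := by
        refine setLIntegral_mono' hS fun x hx => ?_
        have h : x + s • (z - x) = (1 - s) • x + s • z := by module
        rw [h, indicator_of_mem (hconv hx hz hs.le h0 (by ring))]
    _ ≤ ∫⁻ x, S.indicator φ ((1 - s) • x + s • z) := setLIntegral_le_lintegral _ _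
    _ = ∫⁻ y, S.indicator φ (y + s • z) ∂(Measure.map (fun x => (1 - s) • x) volume) := by
        rw [lintegral_map hm (measurable_const_smul _)]
    _ = ENNReal.ofReal |((1 - s) ^ N)⁻¹| * ∫⁻ x in S, φ x := by
        rw [Measure.map_addHaar_smul _ hs.ne', lintegral_smul_measure,
          lintegral_add_right_eq_self (fun y => S.indicator φ y), lintegral_indicator hS]
        simp
    _ ≤ 2 ^ N * ∫⁻ x in S, φ x := by
        gcongr
        rw [abs_of_pos (by positivity), ← inv_pow]
        have h2 : (1 - s)⁻¹ ≤ 2 := by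
          rw [inv_le_comm₀ hs (by norm_num)]
          linarith
        calc ENNReal.ofReal ((1 - s)⁻¹ ^ N) ≤ ENNReal.ofReal (2 ^ N) :=
              ENNReal.ofReal_le_ofReal (pow_le_pow_left₀ (by positivity) h2 N)
          _ = 2 ^ N := by rw [ENNReal.ofReal_pow (by norm_num)]; simp

lemma isBounded_Q (N : ℕ) : Bornology.IsBounded (Q N : Set (Vec N)) := by
  rw [Metric.isBounded_iff_subset_closedBall 0]
  refine ⟨√(∑ _i : Fin N, 1), fun x hx => ?_⟩
  rw [mem_closedBall_zero_iff, EuclideanSpace.norm_eq]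
  refine Real.sqrt_le_sqrt (Finset.sum_le_sum fun i _ => ?_)
  have h := hx i
  rw [Real.norm_eq_abs, sq_abs]
  nlinarith [h.1, h.2]

lemma exists_remainderKernel_bound {m : ℕ}
    (L : (Fin (m + 1) → Fin N) → (Fin m → Fin N) → (Mat N →L[ℝ] Vec N)) :
    ∃ M : ℝ≥0, ∀ x ∈ Q N, ∀ z ∈ Metric.closedBall (0 : Vec N) (1 / 4),
      ‖remainderKernel L x z‖ₑ ≤ M := by
  obtain ⟨C, hC⟩ := ((isBounded_Q N).isCompact_closure.prod
    (isCompact_closedBall (0 : Vec N) (1 / 4))).exists_bound_of_continuousOn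
    (continuous_remainderKernel L).continuousOn
  refine ⟨C.toNNReal, fun x hx z hz => ?_⟩
  have h := hC (x, z) ⟨subset_closure hx, hz⟩
  rw [← ofReal_norm]
  exact ENNReal.ofReal_le_ofReal h

/-- The averaged Taylor polynomial of order `m` at scale `t`. -/
def taylorAverage (m : ℕ) (t : ℝ) (v : Vec N → Vec N) (x : Vec N) : Vec N :=
  ∫ z, taylorKernel m x z • v (x + t • (z - x))

/-- By Tonelli, integrate the remainder in `x` first, with `s` and `z` fixed; the homothety bound
applies and the integral over `s` in `(0, t]` produces the factor `t`. The constant is uniform in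
`S`, so the estimate can be used on cubes exhausting `Q`, where mollified functions are controlled.
-/
lemma exists_taylorAverage_estimate {B : FirstOrderOp N} {m : ℕ}
    {L : (Fin (m + 1) → Fin N) → (Fin m → Fin N) → (Mat N →L[ℝ] Vec N)}
    (hL : ∀ c : List (Fin N) → Vec N, IsPermInvariant c → ∀ ι,
        c (List.ofFn ι) = ∑ κ, L ι κ (∑ i, B i (c (i :: List.ofFn κ)))) :
    ∃ C : ℝ≥0, ∀ v : Vec N → Vec N, ContDiff ℝ ∞ v → ∀ S : Set (Vec N), MeasurableSet S →
      Convex ℝ S → S ⊆ Q N → Metric.closedBall 0 (1 / 4) ⊆ S → ∀ t : ℝ, 0 ≤ t → t ≤ 1 / 2 →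
      ∫⁻ x in S, ‖v x - taylorAverage m t v x‖ₑ ≤
        C * ENNReal.ofReal t * ∫⁻ x in S, ‖B.onFun v x‖ₑ := by
  obtain ⟨M, hM⟩ := exists_remainderKernel_bound L
  set K := Metric.closedBall (0 : Vec N) (1 / 4) with hK
  have hKm : MeasurableSet K := measurableSet_closedBall
  have hKfin : volume K ≠ ⊤ := measure_closedBall_lt_top.ne
  refine ⟨M * (volume K).toNNReal * 2 ^ N, fun v hv S hS hconv hSQ hKS t ht0 ht1 => ?_⟩
  let φ : Vec N → ℝ≥0∞ := fun y => ‖B.onFun v y‖ₑ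
  have hφc : Continuous φ := (contDiff_onFun B hv).continuous.enorm
  have hpt : ∀ x ∈ S, ‖v x - taylorAverage m t v x‖ₑ ≤
      ∫⁻ s in Ioc 0 t, ∫⁻ z in K, M * φ (x + s • (z - x)) := by
    intro x hx
    have h := averaged_taylor hL hv x t
    rw [← sub_eq_iff_eq_add'] at h
    rw [taylorAverage, h, intervalIntegral.integral_of_le ht0]
    refine (enorm_integral_le_lintegral_enorm _).trans (lintegral_mono fun s => ?_)
    refine (enorm_integral_le_lintegral_enorm _).trans ?_
    rw [← lintegral_indicator hKm]
    refine lintegral_mono fun z => ?_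
    by_cases hz : z ∈ K
    · rw [indicator_of_mem hz]
      exact (ContinuousLinearMap.le_opENorm _ _).trans (by gcongr; exact hM x (hSQ hx) z hz)
    · rw [remainderKernel_eq_zero L x hz]
      simp
  let g : Vec N → ℝ × Vec N → ℝ≥0∞ := fun x p => M * φ (x + p.1 • (p.2 - x))
  have hg : Measurable (Function.uncurry g) := by
    have : Continuous fun q : Vec N × (ℝ × Vec N) => φ (q.1 + q.2.1 • (q.2.2 - q.1)) :=
      hφc.comp (by fun_prop)
    exact this.measurable.const_mul _
  let P := (volume.restrict (Ioc 0 t)).prod (volume.restrict K)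
  calc ∫⁻ x in S, ‖v x - taylorAverage m t v x‖ₑ
      ≤ ∫⁻ x in S, (∫⁻ p, g x p ∂P) := by
        refine setLIntegral_mono' hS fun x hx => (hpt x hx).trans_eq ?_
        exact (lintegral_prod (g x) (hg.comp measurable_prodMk_left).aemeasurable).symm
    _ = ∫⁻ p, (∫⁻ x in S, g x p) ∂P := lintegral_lintegral_swap hg.aemeasurable
    _ = ∫⁻ s in Ioc 0 t, ∫⁻ z in K, ∫⁻ x in S, g x (s, z) := by
        rw [lintegral_prod]
        exact (Measurable.lintegral_prod_left' hg).aemeasurable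
    _ ≤ ∫⁻ _s in Ioc 0 t, ∫⁻ _z in K, M * (2 ^ N * ∫⁻ x in S, φ x) := by
        refine setLIntegral_mono' measurableSet_Ioc fun s hs => ?_
        refine setLIntegral_mono' hKm fun z hz => ?_
        have hm : Continuous fun x => φ (x + s • (z - x)) := hφc.comp (by fun_prop)
        simp only [g]
        rw [lintegral_const_mul _ hm.measurable]
        gcongr
        exact lintegral_homothety_le hφc.measurable hS hconv (hKS hz) hs.1.le (hs.2.trans ht1)
    _ = _ := by
        simp only [lintegral_const, Measure.restrict_apply_univ, Real.volume_Ioc, sub_zero]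
        push_cast
        rw [ENNReal.coe_toNNReal hKfin]
        ring

end Estimate

/-! ### Mollification -/

section Mollification

variable {N : ℕ} {F : Type*} [NormedAddCommGroup F] [NormedSpace ℝ F]

/-- The convolution of `g` with the normalized bump function `ρ`. -/
def mollify (ρ : ContDiffBump (0 : Vec N)) (g : Vec N → F) : Vec N → F :=
  fun x => ∫ w, ρ.normed volume (x - w) • g w

lemma mollify_eq_convolution (ρ : ContDiffBump (0 : Vec N)) (g : Vec N → F) :
    mollify ρ g = convolution (ρ.normed volume) g (ContinuousLinearMap.lsmul ℝ ℝ) volume :=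
  funext fun _ => convolution_lsmul_swap.symm

lemma contDiff_mollify [CompleteSpace F] (ρ : ContDiffBump (0 : Vec N)) {g : Vec N → F}
    (hg : LocallyIntegrable g) : ContDiff ℝ ∞ (mollify ρ g) := by
  rw [mollify_eq_convolution]
  exact ρ.hasCompactSupport_normed.contDiff_convolution_left _ ρ.contDiff_normed hg

lemma pd_mollify [CompleteSpace F] (ρ : ContDiffBump (0 : Vec N)) {g : Vec N → F}
    (hg : LocallyIntegrable g) (i : Fin N) (x : Vec N) :
    pd i (mollify ρ g) x = ∫ w, pd i (ρ.normed volume) (x - w) • g w := by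
  have hρ : ContDiff ℝ 1 (ρ.normed volume) := ρ.contDiff_normed (n := 1)
  have h := ρ.hasCompactSupport_normed.hasFDerivAt_convolution_left
    (ContinuousLinearMap.lsmul ℝ ℝ) (μ := volume) hρ hg x
  rw [pd, mollify_eq_convolution, h.fderiv, convolution_def, ContinuousLinearMap.integral_apply]
  · simp only [ContinuousLinearMap.precompL_apply, ContinuousLinearMap.lsmul_apply]
    exact convolution_lsmul_swap (f := pd i (ρ.normed volume)) (g := g) (x := x) (μ := volume)
  · exact (ρ.hasCompactSupport_normed.fderiv (𝕜 := ℝ)).convolutionExists_left _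
      (hρ.continuous_fderiv (by simp)) hg x

/-- The translated and reflected bump function as a test function. -/
def bumpTest {U : Opens (Vec N)} (ρ : ContDiffBump (0 : Vec N)) (x : Vec N)
    (h : Metric.closedBall x ρ.rOut ⊆ U) : 𝓓(U, ℝ) where
  toFun w := ρ.normed volume (x - w)
  contDiff' := ρ.contDiff_normed.comp (contDiff_const.sub contDiff_id)
  hasCompactSupport' := by
    refine HasCompactSupport.of_support_subset_isCompact (isCompact_closedBall x ρ.rOut) ?_
    intro w hw
    have h1 : x - w ∈ Function.support (ρ.normed volume) := hw
    rw [ρ.support_normed_eq, mem_ball_zero_iff] at h1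
    rw [Metric.mem_closedBall, dist_comm, dist_eq_norm]
    exact h1.le
  tsupport_subset' := by
    refine (closure_minimal ?_ Metric.isClosed_closedBall).trans h
    intro w hw
    have h1 : x - w ∈ Function.support (ρ.normed volume) := hw
    rw [ρ.support_normed_eq, mem_ball_zero_iff] at h1
    rw [Metric.mem_closedBall, dist_comm, dist_eq_norm]
    exact h1.le

lemma bumpTest_apply {U : Opens (Vec N)} (ρ : ContDiffBump (0 : Vec N)) (x : Vec N)
    (h : Metric.closedBall x ρ.rOut ⊆ U) (w : Vec N) :
    bumpTest ρ x h w = ρ.normed volume (x - w) := rfl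

lemma pd_bumpTest {U : Opens (Vec N)} (ρ : ContDiffBump (0 : Vec N)) (x : Vec N)
    (h : Metric.closedBall x ρ.rOut ⊆ U) (i : Fin N) (w : Vec N) :
    pd i (bumpTest ρ x h) w = -pd i (ρ.normed volume) (x - w) := by
  have h1 : HasFDerivAt (fun w : Vec N => x - w) (-ContinuousLinearMap.id ℝ (Vec N)) w :=
    (hasFDerivAt_id w).const_sub x
  have hd : Differentiable ℝ (ρ.normed volume) := differentiable_of_smooth ρ.contDiff_normed
  have h2 := (hd (x - w)).hasFDerivAt.comp w h1
  change fderiv ℝ (ρ.normed volume ∘ fun w => x - w) w (e i) = _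
  rw [h2.fderiv]
  simp [pd]

/-- `B` commutes with mollification. Extension by zero creates no boundary term, since the mollifier
centred at `x` is supported in `U`. -/
lemma onFun_mollify (B : FirstOrderOp N) {U : Opens (Vec N)} {u : Vec N → Vec N}
    (hu : IntegrableOn u U) (ρ : ContDiffBump (0 : Vec N)) (x : Vec N)
    (h : Metric.closedBall x ρ.rOut ⊆ U) :
    B.onFun (mollify ρ ((U : Set (Vec N)).indicator u)) x =
      B.onDist U (toDist U u) (bumpTest ρ x h) := by
  have hg : Integrable ((U : Set (Vec N)).indicator u) :=
    (integrable_indicator_iff U.isOpen.measurableSet).2 hu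
  rw [onDist_toDist_apply B hu.locallyIntegrableOn, FirstOrderOp.onFun, ← Finset.sum_neg_distrib]
  refine Finset.sum_congr rfl fun i _ => ?_
  rw [pd_mollify ρ hg.locallyIntegrable, ← map_neg, ← integral_neg]
  congr 2
  ext1 w
  by_cases hw : w ∈ U
  · rw [indicator_of_mem (by exact hw), pd_bumpTest, neg_smul, neg_neg]
  · have h0 : pd i (bumpTest ρ x h) w = 0 := by
      refine image_eq_zero_of_notMem_tsupport fun hw' => hw ?_
      exact (bumpTest ρ x h).tsupport_subset (tsupport_pdl_subset [i] (bumpTest ρ x h) hw')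
    rw [h0, indicator_of_notMem (by exact hw)]
    simp

/-- Averaging a measure against a probability density does not increase its mass, by Tonelli. This
holds for every measure representing `B u`, hence for the infimum. -/
lemma lintegral_onFun_mollify_le (B : FirstOrderOp N) {U : Opens (Vec N)} {u : Vec N → Vec N}
    (hu : IntegrableOn u U) (ρ : ContDiffBump (0 : Vec N)) {S : Set (Vec N)}
    (hS : MeasurableSet S) (h : ∀ x ∈ S, Metric.closedBall x ρ.rOut ⊆ U) :
    ∫⁻ x in S, ‖B.onFun (mollify ρ ((U : Set (Vec N)).indicator u)) x‖ₑ ≤ totalVar B U u := by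
  refine le_iInf₂ fun μ hμ => ?_
  have := hμ.finite
  have hc : Continuous (ρ.normed (volume : Measure (Vec N))) := ρ.continuous_normed
  have hm : Measurable (Function.uncurry fun x w : Vec N => ‖ρ.normed volume (x - w)‖ₑ) := by
    have : Continuous fun p : Vec N × Vec N => ‖ρ.normed volume (p.1 - p.2)‖ₑ :=
      (hc.comp (by fun_prop)).enorm
    exact this.measurable
  have h1 : ∀ w : Vec N, ∫⁻ x, ‖ρ.normed volume (x - w)‖ₑ = 1 := by
    intro w
    rw [lintegral_sub_right_eq_self (fun x => ‖ρ.normed volume x‖ₑ) w]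
    have h2 : ∀ x, ‖ρ.normed volume x‖ₑ = ENNReal.ofReal (ρ.normed volume x) := fun x =>
      Real.enorm_of_nonneg (ρ.nonneg_normed x)
    simp only [h2]
    rw [← ofReal_integral_eq_lintegral_ofReal ρ.integrable_normed
      (Eventually.of_forall ρ.nonneg_normed), ρ.integral_normed, ENNReal.ofReal_one]
  calc ∫⁻ x in S, ‖B.onFun (mollify ρ ((U : Set (Vec N)).indicator u)) x‖ₑ
      ≤ ∫⁻ x in S, ∫⁻ w in U, ‖ρ.normed volume (x - w)‖ₑ ∂μ.variation := by
        refine setLIntegral_mono' hS fun x hx => ?_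
        rw [onFun_mollify B hu ρ x (h x hx), hμ.eq]
        refine VectorMeasure.enorm_integral_le_lintegral_enorm.trans ?_
        calc _ ≤ 1 * ∫⁻ w, ‖bumpTest ρ x (h x hx) w‖ₑ ∂μ.variation := by
              gcongr
              exact ContinuousLinearMap.opENorm_lsmul_le
          _ ≤ _ := by
              rw [one_mul, ← lintegral_indicator U.isOpen.measurableSet]
              refine lintegral_mono fun w => ?_
              by_cases hw : w ∈ (U : Set (Vec N))
              · rw [indicator_of_mem hw, bumpTest_apply]
              · have h0 : bumpTest ρ x (h x hx) w = 0 :=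
                  image_eq_zero_of_notMem_tsupport fun hw' =>
                    hw ((bumpTest ρ x (h x hx)).tsupport_subset hw')
                rw [h0]
                simp
    _ = ∫⁻ w in U, (∫⁻ x in S, ‖ρ.normed volume (x - w)‖ₑ) ∂μ.variation :=
        lintegral_lintegral_swap hm.aemeasurable
    _ ≤ ∫⁻ w in U, 1 ∂μ.variation :=
        lintegral_mono fun w => (setLIntegral_le_lintegral _ _).trans (h1 w).le
    _ = μ.variation U := by simp

/-- The bump is even, so Fubini moves the mollification from `g` to `κ`. The mollified `κ` converges
pointwise and stays below the bound of `κ`, which gives dominated convergence. -/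
lemma tendsto_integral_smul_mollify [CompleteSpace F] {ρ : ℕ → ContDiffBump (0 : Vec N)}
    (hρ : Tendsto (fun n => (ρ n).rOut) atTop (𝓝 0)) {g : Vec N → F} (hg : Integrable g)
    {κ : Vec N → ℝ} (hκ : Continuous κ) (hκc : HasCompactSupport κ) :
    Tendsto (fun n => ∫ y, κ y • mollify (ρ n) g y) atTop (𝓝 (∫ y, κ y • g y)) := by
  have hκi : Integrable κ := hκ.integrable_of_hasCompactSupport hκc
  obtain ⟨M, hM⟩ := hκc.exists_bound_of_continuous hκ
  have hswap : ∀ n, ∫ y, κ y • mollify (ρ n) g y = ∫ w, mollify (ρ n) κ w • g w := by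
    intro n
    have hc : Continuous ((ρ n).normed (volume : Measure (Vec N))) := (ρ n).continuous_normed
    obtain ⟨R, hR⟩ := (ρ n).hasCompactSupport_normed.exists_bound_of_continuous hc
    have hint : Integrable (Function.uncurry fun y w : Vec N =>
        κ y • (ρ n).normed volume (y - w) • g w) (volume.prod volume) := by
      have h1 : Integrable (fun p : Vec N × Vec N => κ p.1 • g p.2) (volume.prod volume) :=
        hκi.smul_prod hg
      have h2 : Continuous fun p : Vec N × Vec N => (ρ n).normed volume (p.1 - p.2) :=
        hc.comp (by fun_prop)
      refine (h1.bdd_smul R h2.aestronglyMeasurable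
        (Eventually.of_forall fun p => hR _)).congr (Eventually.of_forall fun p => ?_)
      exact smul_comm _ _ _
    simp only [mollify, ← integral_smul, ← integral_smul_const]
    rw [integral_integral_swap hint]
    congr 1
    ext1 w
    congr 1
    ext1 y
    rw [← (ρ n).normed_neg (y - w), neg_sub, smul_smul, mul_comm, smul_eq_mul]
  simp only [hswap]
  refine tendsto_integral_of_dominated_convergence (fun w => M * ‖g w‖) ?_ (hg.norm.const_mul M)
    ?_ ?_
  · intro n
    exact (contDiff_mollify (ρ n)
      hκi.locallyIntegrable).continuous.aestronglyMeasurable.smul hg.aestronglyMeasurable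
  · intro n
    refine Eventually.of_forall fun w => ?_
    rw [norm_smul]
    gcongr
    have hi : Integrable fun y => (ρ n).normed volume (w - y) :=
      ((ρ n).integrable_normed).comp_sub_left w
    calc ‖mollify (ρ n) κ w‖ ≤ ∫ y, (ρ n).normed volume (w - y) * M := by
          refine norm_integral_le_of_norm_le (hi.mul_const M) (Eventually.of_forall fun y => ?_)
          rw [norm_smul, Real.norm_of_nonneg ((ρ n).nonneg_normed _)]
          exact mul_le_mul_of_nonneg_left (hM y) ((ρ n).nonneg_normed _)
      _ = M := by
          rw [integral_mul_const, integral_sub_left_eq_self (fun y => (ρ n).normed volume y),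
            (ρ n).integral_normed, one_mul]
  · refine Eventually.of_forall fun w => Tendsto.smul_const ?_ _
    simp only [mollify_eq_convolution]
    exact ContDiffBump.convolution_tendsto_right_of_continuous hρ hκ w

end Mollification

/-! ### The averaged Taylor polynomial of an integrable function -/

section Average

variable {N : ℕ}

/-- The integral kernel of `taylorAverage`. -/
def averageKernel (m : ℕ) (t : ℝ) (x y : Vec N) : ℝ :=
  |(t ^ N)⁻¹| * taylorKernel m x (x + t⁻¹ • (y - x))

lemma continuous_averageKernel (m : ℕ) (t : ℝ) :
    Continuous (Function.uncurry (averageKernel (N := N) m t)) := by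
  have h : Continuous fun p : Vec N × Vec N => (p.1, p.1 + t⁻¹ • (p.2 - p.1)) := by fun_prop
  exact continuous_const.fun_mul ((continuous_taylorKernel m).comp h)

lemma hasCompactSupport_averageKernel (m : ℕ) {t : ℝ} (ht : t ≠ 0) (x : Vec N) :
    HasCompactSupport (averageKernel m t x) := by
  refine HasCompactSupport.of_support_subset_isCompact
    ((isCompact_closedBall (0 : Vec N) (1 / 4)).image
      (f := fun z => x + t • (z - x)) (by fun_prop)) fun y hy => ?_
  refine ⟨x + t⁻¹ • (y - x), ?_, ?_⟩
  · by_contra h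
    exact hy (by rw [averageKernel, taylorKernel_eq_zero m x h, mul_zero])
  · simp [smul_smul, ht]

/-- The substitution `y = x + t (z - x)` exhibits a genuine integral operator, whose kernel is
continuous for each fixed `t ≠ 0`. -/
lemma taylorAverage_eq (m : ℕ) {t : ℝ} (ht : t ≠ 0) (v : Vec N → Vec N) (x : Vec N) :
    taylorAverage m t v x = ∫ y, averageKernel m t x y • v y := by
  let H : Vec N → Vec N := fun y => taylorKernel m x (x + t⁻¹ • (y - x)) • v y
  have h1 : ∀ z, taylorKernel m x z • v (x + t • (z - x)) = H ((x - t • x) + t • z) := by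
    intro z
    have h2 : (x - t • x) + t • z = x + t • (z - x) := by module
    have h3 : x + t⁻¹ • (x + t • (z - x) - x) = z := by simp [smul_smul, ht]
    simp only [H, h2, h3]
  simp only [taylorAverage, h1]
  rw [Measure.integral_comp_smul volume (fun y => H ((x - t • x) + y)) t,
    integral_add_left_eq_self H, ← integral_smul]
  simp [averageKernel, H, mul_smul]

lemma continuous_taylorAverage (m : ℕ) {t : ℝ} {v : Vec N → Vec N} (hv : Continuous v) :
    Continuous (taylorAverage m t v) := by
  have h : Continuous (Function.uncurry fun x z : Vec N =>
      taylorKernel m x z • v (x + t • (z - x))) :=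
    (continuous_taylorKernel m).fun_smul (hv.comp (by fun_prop))
  have h2 : taylorAverage m t v = fun x => ∫ z in Metric.closedBall (0 : Vec N) (1 / 4),
      taylorKernel m x z • v (x + t • (z - x)) := by
    ext1 x
    refine (setIntegral_eq_integral_of_forall_compl_eq_zero fun z hz => ?_).symm
    rw [taylorKernel_eq_zero m x hz, zero_smul]
  rw [h2]
  exact continuous_parametric_integral_of_continuous h (isCompact_closedBall _ _)

/-- Standard mollifiers with radii `1 / (8 (n + 1))`. -/
def stdBump (N n : ℕ) : ContDiffBump (0 : Vec N) where
  -- The fixed ratio 2 of the radii is used for almost everywhere convergence. Outer radius at most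
  -- `1/8` leaves an inner cube of half side at least `3/8`, which contains the ball of radius `1/4`
  -- carrying the weight.
  rIn := 1 / (16 * ((n : ℝ) + 1))
  rOut := 1 / (8 * ((n : ℝ) + 1))
  rIn_pos := by positivity
  rIn_lt_rOut := by
    apply one_div_lt_one_div_of_lt (by positivity)
    nlinarith [(Nat.cast_nonneg n : (0 : ℝ) ≤ n)]

lemma tendsto_stdBump_rOut (N : ℕ) : Tendsto (fun n => (stdBump N n).rOut) atTop (𝓝 0) := by
  have h := (tendsto_one_div_add_atTop_nhds_zero_nat (𝕜 := ℝ)).const_mul (1 / 8)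
  rw [mul_zero] at h
  refine h.congr fun n => ?_
  simp only [stdBump]
  rw [one_div_mul_one_div]

lemma stdBump_rOut_le (N n : ℕ) : (stdBump N n).rOut ≤ 1 / 8 := by
  simp only [stdBump]
  apply one_div_le_one_div_of_le (by norm_num)
  nlinarith [(Nat.cast_nonneg n : (0 : ℝ) ≤ n)]

/-- The cube of points at distance more than `δ` from the faces of the unit cube. -/
def innerCube (N : ℕ) (δ : ℝ) : Set (Vec N) := {x | ∀ i, |x i| < 1 / 2 - δ}

lemma measurableSet_innerCube (N : ℕ) (δ : ℝ) : MeasurableSet (innerCube N δ) := by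
  have h : innerCube N δ = ⋂ i, {x : Vec N | |x i| < 1 / 2 - δ} := by
    ext x
    simp [innerCube]
  rw [h]
  exact MeasurableSet.iInter fun i => (isOpen_lt (by fun_prop) continuous_const).measurableSet

lemma convex_innerCube (N : ℕ) (δ : ℝ) : Convex ℝ (innerCube N δ) := by
  intro x hx y hy a b ha hb hab i
  have h1 := abs_lt.1 (hx i)
  have h2 := abs_lt.1 (hy i)
  have h := (convex_Ioo (-(1 / 2 - δ)) (1 / 2 - δ)) h1 h2 ha hb hab
  exact abs_lt.2 h

lemma abs_apply_le_norm (x : Vec N) (i : Fin N) : |x i| ≤ ‖x‖ := PiLp.norm_apply_le x i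

lemma closedBall_subset_Q {δ : ℝ} {x : Vec N} (hx : x ∈ innerCube N δ) :
    Metric.closedBall x δ ⊆ Q N := by
  intro y hy i
  have h1 := abs_apply_le_norm (y - x) i
  rw [Metric.mem_closedBall, dist_eq_norm] at hy
  have h2 := abs_lt.1 (hx i)
  have h3 := abs_le.1 (h1.trans hy)
  rw [PiLp.sub_apply] at h3
  constructor <;> linarith [h2.1, h2.2, h3.1, h3.2]

lemma eventually_mem_innerCube {x : Vec N} (hx : x ∈ Q N) {δ : ℕ → ℝ}
    (hδ : Tendsto δ atTop (𝓝 0)) : ∀ᶠ n in atTop, x ∈ innerCube N (δ n) := by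
  refine eventually_all.2 fun i => ?_
  have h : |x i| < 1 / 2 := abs_lt.2 (hx i)
  filter_upwards [hδ.eventually_lt_const (sub_pos.2 h)] with n hn
  linarith

lemma tendsto_taylorAverage_mollify (m : ℕ) {t : ℝ} (ht : t ≠ 0) {g : Vec N → Vec N}
    (hg : Integrable g) (x : Vec N) :
    Tendsto (fun n => taylorAverage m t (mollify (stdBump N n) g) x) atTop
      (𝓝 (taylorAverage m t g x)) := by
  have hκ : Continuous (averageKernel m t x) :=
    Continuous.uncurry_left x (continuous_averageKernel m t)
  have h := tendsto_integral_smul_mollify (ρ := stdBump N) (κ := averageKernel m t x)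
    (tendsto_stdBump_rOut N) hg hκ (hasCompactSupport_averageKernel m ht x)
  rw [← taylorAverage_eq m ht g x] at h
  exact h.congr fun n => (taylorAverage_eq m ht (mollify (stdBump N n) g) x).symm

lemma ae_tendsto_mollify {g : Vec N → Vec N} (hg : Integrable g) :
    ∀ᵐ x, Tendsto (fun n => mollify (stdBump N n) g x) atTop (𝓝 (g x)) := by
  simp only [mollify_eq_convolution]
  have h : ∀ n, (stdBump N n).rOut ≤ 2 * (stdBump N n).rIn := fun n => by
    simp only [stdBump]
    apply le_of_eq
    field_simp
    norm_num
  exact ContDiffBump.ae_convolution_tendsto_right_of_locallyIntegrable (K := 2)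
    (tendsto_stdBump_rOut N) (Eventually.of_forall h) hg.locallyIntegrable

/-- The averaged Taylor polynomial approximates a function `u` in `L¹(Q)` with an error controlled
by the total variation of `B u`. -/
lemma exists_taylorAverage_estimate_totalVar {B : FirstOrderOp N} {m : ℕ}
    {L : (Fin (m + 1) → Fin N) → (Fin m → Fin N) → (Mat N →L[ℝ] Vec N)}
    (hL : ∀ c : List (Fin N) → Vec N, IsPermInvariant c → ∀ ι,
        c (List.ofFn ι) = ∑ κ, L ι κ (∑ i, B i (c (i :: List.ofFn κ)))) :
    ∃ C : ℝ≥0, ∀ u : Vec N → Vec N, IntegrableOn u (Q N) → ∀ t : ℝ, 0 < t → t ≤ 1 / 2 →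
      ∫⁻ x in Q N, ‖u x - taylorAverage m t ((Q N : Set (Vec N)).indicator u) x‖ₑ ≤
        C * ENNReal.ofReal t * totalVar B (Q N) u := by
  obtain ⟨C, hC⟩ := exists_taylorAverage_estimate hL
  refine ⟨C, fun u hu t ht ht2 => ?_⟩
  set g := (Q N : Set (Vec N)).indicator u with hgdef
  have hQ : MeasurableSet (Q N : Set (Vec N)) := (Q N).isOpen.measurableSet
  have hg : Integrable g := (integrable_indicator_iff hQ).2 hu
  let ρ := stdBump N
  let v : ℕ → Vec N → Vec N := fun n => mollify (ρ n) g
  let S : ℕ → Set (Vec N) := fun n => innerCube N (ρ n).rOut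
  have hv : ∀ n, ContDiff ℝ ∞ (v n) := fun n => contDiff_mollify (ρ n) hg.locallyIntegrable
  have hS : ∀ n, MeasurableSet (S n) := fun n => measurableSet_innerCube N _
  -- The estimate for `v n` is available on `S n` only; cutting off there loses nothing in the
  -- limit, as each point of `Q` lies in `S n` eventually. Fatou's lemma then concludes.
  let f : ℕ → Vec N → ℝ≥0∞ := fun n => (S n).indicator fun x => ‖v n x - taylorAverage m t (v n) x‖ₑ
  have hf : ∀ n, Measurable (f n) := fun n =>
    (((hv n).continuous.sub
      (continuous_taylorAverage m (hv n).continuous)).enorm.measurable).indicator (hS n)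
  have hbound : ∀ n, ∫⁻ x in Q N, f n x ≤ C * ENNReal.ofReal t * totalVar B (Q N) u := by
    intro n
    have hSQ : S n ⊆ Q N := fun x hx =>
      closedBall_subset_Q hx (Metric.mem_closedBall_self (ρ n).rOut_pos.le)
    have hball : Metric.closedBall (0 : Vec N) (1 / 4) ⊆ S n := by
      intro x hx i
      rw [mem_closedBall_zero_iff] at hx
      have h1 := abs_apply_le_norm x i
      have h2 := stdBump_rOut_le N n
      simp only [ρ]
      linarith
    calc ∫⁻ x in Q N, f n x ≤ ∫⁻ x, f n x := setLIntegral_le_lintegral _ _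
      _ = ∫⁻ x in S n, ‖v n x - taylorAverage m t (v n) x‖ₑ := lintegral_indicator (hS n) _
      _ ≤ C * ENNReal.ofReal t * ∫⁻ x in S n, ‖B.onFun (v n) x‖ₑ :=
          hC (v n) (hv n) (S n) (hS n) (convex_innerCube N _) hSQ hball t ht.le ht2
      _ ≤ C * ENNReal.ofReal t * totalVar B (Q N) u := by
          gcongr
          exact lintegral_onFun_mollify_le B hu (ρ n) (hS n) fun x hx => closedBall_subset_Q hx
  have hlim : ∀ᵐ x ∂(volume.restrict (Q N : Set (Vec N))),
      ‖u x - taylorAverage m t g x‖ₑ = liminf (fun n => f n x) atTop := by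
    rw [ae_restrict_iff' hQ]
    filter_upwards [ae_tendsto_mollify hg] with x hx hxQ
    have h1 : Tendsto (fun n => v n x) atTop (𝓝 (u x)) := by
      have h3 : g x = u x := indicator_of_mem hxQ u
      rwa [h3] at hx
    have h2 : Tendsto (fun n => taylorAverage m t (v n) x) atTop (𝓝 (taylorAverage m t g x)) :=
      tendsto_taylorAverage_mollify m ht.ne' hg x
    refine (Tendsto.liminf_eq ?_).symm
    refine (h1.sub h2).enorm.congr' ?_
    filter_upwards [eventually_mem_innerCube hxQ (tendsto_stdBump_rOut N)] with n hn
    exact (indicator_of_mem (s := S n) hn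
      fun x => ‖v n x - taylorAverage m t (v n) x‖ₑ).symm
  rw [lintegral_congr_ae hlim]
  refine (lintegral_liminf_le hf).trans ?_
  exact liminf_le_of_frequently_le' (Frequently.of_forall hbound)

end Average

/-! ### Finite rank approximation and compactness -/

section Compactness

variable {N : ℕ}

/-- The function equal to `w k` on the `k`-th cell of a finite partition, as an element of
`L¹`. -/
def stepL1 (U : Opens (Vec N)) [IsFiniteMeasure (volume.restrict (U : Set (Vec N)))] {n : ℕ}
    (J : SimpleFunc (Vec N) ℕ) : (Fin (n + 1) → Vec N) →ₗ[ℝ] L1 U where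
  -- `Fin.ofNat` reduces modulo `n + 1`; this has no effect in the application, where `J` takes
  -- values at most `n`.
  toFun w := ((J.map fun k => w (Fin.ofNat (n + 1) k)).memLp_of_isFiniteMeasure 1
    (volume.restrict (U : Set (Vec N)))).toLp
  map_add' _ _ := rfl
  map_smul' _ _ := rfl

lemma coeFn_stepL1 (U : Opens (Vec N)) [IsFiniteMeasure (volume.restrict (U : Set (Vec N)))]
    {n : ℕ} (J : SimpleFunc (Vec N) ℕ) (w : Fin (n + 1) → Vec N) :
    stepL1 U J w =ᵐ[volume.restrict (U : Set (Vec N))] fun x => w (Fin.ofNat (n + 1) (J x)) :=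
  MemLp.coeFn_toLp (SimpleFunc.memLp_of_isFiniteMeasure _ 1 _)

lemma integrable_smul_L1 {U : Opens (Vec N)} {a : Vec N → ℝ} (ha : Continuous a) {c : ℝ}
    (hac : ∀ y ∈ U, ‖a y‖ ≤ c) (u : L1 U) : IntegrableOn (fun y => a y • u y) U :=
  (L1.integrable_coeFn u).bdd_smul c ha.aestronglyMeasurable
    ((ae_restrict_iff' U.isOpen.measurableSet).2 (Eventually.of_forall hac))

lemma norm_integral_smul_L1_le {U : Opens (Vec N)} {a : Vec N → ℝ} {c : ℝ}
    (hac : ∀ y ∈ U, ‖a y‖ ≤ c) (u : L1 U) : ‖∫ y in U, a y • u y‖ ≤ c * ‖u‖ := by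
  rw [L1.norm_eq_integral_norm, ← integral_const_mul]
  refine norm_integral_le_of_norm_le ((L1.integrable_coeFn u).norm.const_mul c)
    ((ae_restrict_iff' U.isOpen.measurableSet).2 (Eventually.of_forall fun y hy => ?_))
  rw [norm_smul]
  exact mul_le_mul_of_nonneg_right (hac y hy) (norm_nonneg _)

/-- A bounded set has a finite measurable partition into cells of small diameter, given by the index
of the nearest point in a finite sequence. -/
lemma exists_simpleFunc_dist_lt {S : Set (Vec N)} (hS : Bornology.IsBounded S) (hne : S.Nonempty)
    {δ : ℝ} (hδ : 0 < δ) : ∃ (n : ℕ) (p : ℕ → Vec N) (J : SimpleFunc (Vec N) ℕ),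
      (∀ k, p k ∈ S) ∧ (∀ x, J x ≤ n) ∧ ∀ x ∈ S, dist x (p (J x)) < δ := by
  obtain ⟨x₀, hx₀⟩ := hne
  obtain ⟨P, hPS, hPfin, hPcov⟩ :=
    exists_finite_cover_balls_of_isCompact_closure hS.isCompact_closure hδ
  let l := hPfin.toFinset.toList
  -- The default `x₀` keeps every `p k` in `S`, including the index `l.length` that `nearestPtInd`
  -- may return.
  let p : ℕ → Vec N := fun k => l.getD k x₀
  refine ⟨l.length, p, SimpleFunc.nearestPtInd p l.length, fun k => ?_,
    SimpleFunc.nearestPtInd_le _ _, fun x hx => ?_⟩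
  · by_cases hk : k < l.length
    · have h : p k ∈ l := by simp [p, hk]
      exact hPS (by simpa [l] using h)
    · simpa [p, not_lt.1 hk] using hx₀
  · obtain ⟨q, hq, hxq⟩ := mem_iUnion₂.1 (hPcov hx)
    obtain ⟨k, hk, rfl⟩ := List.getElem_of_mem (show q ∈ l by simpa [l] using hq)
    have h : edist (p (SimpleFunc.nearestPtInd p l.length x)) x ≤ edist (p k) x :=
      SimpleFunc.edist_nearestPt_le p x hk.le
    have hpk : p k = l[k] := by simp [p, hk]
    rw [edist_dist, edist_dist, ENNReal.ofReal_le_ofReal_iff dist_nonneg, hpk] at h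
    rw [dist_comm]
    exact h.trans_lt (by rwa [dist_comm])

/-- Integral operators with a continuous kernel can be approximated by maps with values in a
compact set. -/
lemma exists_compact_approx {k : Vec N → Vec N → ℝ} (hk : Continuous (Function.uncurry k))
    {U : Opens (Vec N)} (hU : Bornology.IsBounded (U : Set (Vec N)))
    (hne : (U : Set (Vec N)).Nonempty) {η : ℝ} (hη : 0 < η) :
    ∃ T : Set (L1 U), IsCompact T ∧ ∀ u : L1 U, ‖u‖ ≤ 1 → ∃ s ∈ T,
      ∫⁻ x in U, ‖(∫ y in U, k x y • u y) - s x‖ₑ ≤ ENNReal.ofReal η := by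
  have hUm : MeasurableSet (U : Set (Vec N)) := U.isOpen.measurableSet
  have hvol : volume (U : Set (Vec N)) < ⊤ := hU.measure_lt_top
  have : IsFiniteMeasure (volume.restrict (U : Set (Vec N))) := ⟨by simpa using hvol⟩
  have hAc : IsCompact (closure (U : Set (Vec N))) := hU.isCompact_closure
  have hUA : (U : Set (Vec N)) ⊆ closure (U : Set (Vec N)) := subset_closure
  have hkr : ∀ x, Continuous (k x) := fun x => hk.comp (Continuous.prodMk_right x)
  obtain ⟨M, hM⟩ := (hAc.prod hAc).exists_bound_of_continuousOn hk.continuousOn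
  have hMU : ∀ x ∈ U, ∀ y ∈ U, ‖k x y‖ ≤ M := fun x hx y hy => hM (x, y) ⟨hUA hx, hUA hy⟩
  let V : ℝ := volume.real (U : Set (Vec N))
  have hV : 0 ≤ V := measureReal_nonneg
  -- A pointwise error `η'` integrates to at most `η' * V ≤ η`; the `+ 1` keeps the denominator
  -- positive.
  let η' := η / (V + 1)
  have hη' : 0 < η' := by positivity
  obtain ⟨δ, hδ, hunif⟩ := Metric.uniformContinuousOn_iff.1
    ((hAc.prod hAc).uniformContinuousOn_of_continuous hk.continuousOn) η' hη'
  obtain ⟨n, p, J, hpU, hJ, hdist⟩ := exists_simpleFunc_dist_lt hU hne hδ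
  -- Freezing the first argument of `k` at the sample points yields step functions whose finitely
  -- many values are bounded by `M`. They form a continuous linear image of a compact product of
  -- balls.
  refine ⟨stepL1 U (n := n) J '' (Set.univ.pi fun _ => Metric.closedBall 0 M),
    (isCompact_univ_pi fun _ => isCompact_closedBall _ _).image
      (LinearMap.continuous_of_finiteDimensional _), fun u hu => ?_⟩
  let w : Fin (n + 1) → Vec N := fun j => ∫ y in U, k (p j) y • u y
  refine ⟨stepL1 U J w, mem_image_of_mem _ fun j _ => ?_, ?_⟩
  · have hM0 : 0 ≤ M := (norm_nonneg _).trans (hMU _ (hpU 0) _ (hpU 0))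
    rw [mem_closedBall_zero_iff]
    exact (norm_integral_smul_L1_le (hMU _ (hpU j)) u).trans (mul_le_of_le_one_right hM0 hu)
  have hpt : ∀ᵐ x ∂(volume.restrict (U : Set (Vec N))),
      ‖(∫ y in U, k x y • u y) - stepL1 U J w x‖ₑ ≤ ENNReal.ofReal η' := by
    filter_upwards [coeFn_stepL1 U J w, ae_restrict_mem hUm] with x hx hxU
    have hw : w (Fin.ofNat (n + 1) (J x)) = ∫ y in U, k (p (J x)) y • u y := by
      simp only [w, Fin.val_ofNat, Nat.mod_eq_of_lt (Nat.lt_succ_of_le (hJ x))]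
    rw [hx, hw, ← integral_sub (integrable_smul_L1 (hkr x) (hMU x hxU) u)
      (integrable_smul_L1 (hkr _) (hMU _ (hpU _)) u), ← ofReal_norm]
    refine ENNReal.ofReal_le_ofReal ?_
    simp only [← sub_smul]
    refine (norm_integral_smul_L1_le (a := fun y => k x y - k (p (J x)) y) (c := η')
      (fun y hy => ?_) u).trans (mul_le_of_le_one_right hη'.le hu)
    have h := hunif (x, y) ⟨hUA hxU, hUA hy⟩ (p (J x), y) ⟨hUA (hpU _), hUA hy⟩
      (by simpa [Prod.dist_eq, hδ] using hdist x hxU)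
    rw [← dist_eq_norm]
    exact h.le
  calc ∫⁻ x in U, ‖(∫ y in U, k x y • u y) - stepL1 U J w x‖ₑ
      ≤ ∫⁻ _x in U, ENNReal.ofReal η' := lintegral_mono_ae hpt
    _ = ENNReal.ofReal η' * ENNReal.ofReal V := by
        rw [lintegral_const, Measure.restrict_apply_univ, ofReal_measureReal hvol.ne]
    _ = ENNReal.ofReal (η' * V) := (ENNReal.ofReal_mul hη'.le).symm
    _ ≤ ENNReal.ofReal η := by
        refine ENNReal.ofReal_le_ofReal ?_
        rw [div_mul_eq_mul_div, div_le_iff₀ (by positivity)]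
        nlinarith

lemma totallyBounded_of_approx {X : Type*} [PseudoMetricSpace X] {A : Set X}
    (h : ∀ η > 0, ∃ T : Set X, TotallyBounded T ∧ ∀ a ∈ A, ∃ s ∈ T, dist a s ≤ η) :
    TotallyBounded A := by
  refine Metric.totallyBounded_iff.2 fun ε hε => ?_
  obtain ⟨T, hT, hA⟩ := h (ε / 2) (by positivity)
  obtain ⟨P, hP, hcov⟩ := Metric.totallyBounded_iff.1 hT (ε / 2) (by positivity)
  refine ⟨P, hP, fun a ha => ?_⟩
  obtain ⟨s, hs, has⟩ := hA a ha
  obtain ⟨q, hq, hsq⟩ := mem_iUnion₂.1 (hcov hs)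
  refine mem_iUnion₂.2 ⟨q, hq, ?_⟩
  rw [Metric.mem_ball] at hsq ⊢
  linarith [dist_triangle a s q]

lemma dist_L1_eq {U : Opens (Vec N)} (u v : L1 U) :
    dist u v = (∫⁻ x in U, ‖u x - v x‖ₑ).toReal := by
  rw [Lp.dist_def, eLpNorm_one_eq_lintegral_enorm]
  rfl

lemma Q_nonempty (N : ℕ) : (Q N : Set (Vec N)).Nonempty :=
  ⟨0, fun i => by simp⟩

/-- If the null-space of `B` is finite dimensional, then bounded sets of `BV_B(Q)` are totally
bounded in `L¹(Q)`. -/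
lemma totallyBounded_image_toL1 (B : FirstOrderOp N) (h : FiniteDimensional ℝ B.nullSpace) :
    TotallyBounded (BV.toL1 B (Q N) '' Metric.closedBall 0 1) := by
  obtain ⟨m, L, hL⟩ := exists_symbol_leftInverse B h
  obtain ⟨C, hC⟩ := exists_taylorAverage_estimate_totalVar hL
  refine totallyBounded_of_approx fun η hη => ?_
  -- The remainder may use half of `η`, and the Taylor estimate needs `t ≤ 1/2`. With `t` now fixed,
  -- the other half goes to the compact approximation of the averaging operator.
  let t : ℝ := min (1 / 2) (η / 2 / (C + 1))
  have ht : 0 < t := by positivity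
  have htC : C * t ≤ η / 2 := by
    have h1 : t * (C + 1) ≤ η / 2 := (le_div_iff₀ (by positivity)).1 (min_le_right _ _)
    nlinarith
  obtain ⟨T, hT, hTapprox⟩ := exists_compact_approx (continuous_averageKernel m t) (isBounded_Q N)
    (Q_nonempty N) (half_pos hη)
  refine ⟨T, hT.totallyBounded, ?_⟩
  rintro _ ⟨b, hb, rfl⟩
  rw [mem_closedBall_zero_iff, BV.norm_def] at hb
  set u := BV.toL1 B (Q N) b with hu
  have hu1 : ‖u‖ ≤ 1 := by linarith [ENNReal.toReal_nonneg (a := totalVar B (Q N) u)]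
  have hu2 : totalVar B (Q N) u ≤ 1 := by
    rw [← ENNReal.ofReal_toReal b.totalVar_ne_top]
    exact (ENNReal.ofReal_le_ofReal (by linarith [norm_nonneg u])).trans ENNReal.ofReal_one.le
  obtain ⟨s, hs, hsu⟩ := hTapprox u hu1
  refine ⟨s, hs, ?_⟩
  have hT1 : ∀ x, taylorAverage m t ((Q N : Set (Vec N)).indicator u) x =
      ∫ y in Q N, averageKernel m t x y • u y := by
    intro x
    rw [taylorAverage_eq m ht.ne', ← integral_indicator (Q N).isOpen.measurableSet]
    congr 1
    ext1 y
    exact (indicator_const_smul_apply _ _ _ _).symm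
  have h1 := hC u (L1.integrable_coeFn u) t ht (min_le_left _ _)
  simp only [hT1] at h1
  rw [dist_L1_eq]
  refine ENNReal.toReal_le_of_le_ofReal hη.le ?_
  calc ∫⁻ x in Q N, ‖u x - s x‖ₑ
      ≤ ∫⁻ x in Q N, (‖u x - ∫ y in Q N, averageKernel m t x y • u y‖ₑ +
          ‖(∫ y in Q N, averageKernel m t x y • u y) - s x‖ₑ) := by
        refine lintegral_mono fun x => ?_
        rw [← sub_add_sub_cancel (u x) (∫ y in Q N, averageKernel m t x y • u y) (s x)]
        exact enorm_add_le _ _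
    _ ≤ ENNReal.ofReal (η / 2) + ENNReal.ofReal (η / 2) := by
        rw [lintegral_add_right']
        · gcongr
          calc _ ≤ C * ENNReal.ofReal t * totalVar B (Q N) u := h1
            _ ≤ C * ENNReal.ofReal t * 1 := by gcongr
            _ = ENNReal.ofReal (C * t) := by
                rw [mul_one, ENNReal.ofReal_mul NNReal.zero_le_coe, ENNReal.ofReal_coe_nnreal]
            _ ≤ ENNReal.ofReal (η / 2) := ENNReal.ofReal_le_ofReal htC
        · have hint : AEStronglyMeasurable (fun p : Vec N × Vec N => averageKernel m t p.1 p.2 • u p.2)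
              ((volume.restrict (Q N : Set (Vec N))).prod
                (volume.restrict (Q N : Set (Vec N)))) :=
            (continuous_averageKernel m t).aestronglyMeasurable.smul
              (Lp.aestronglyMeasurable u).comp_snd
          exact (hint.integral_prod_right'.sub (Lp.aestronglyMeasurable s)).enorm
    _ = ENNReal.ofReal η := by
        rw [← ENNReal.ofReal_add (by positivity) (by positivity), add_halves]

end Compactness

end BVB

end

theorem proposition6p7 (N : ℕ) (A : BVB.DiffOp N) (B : BVB.FirstOrderOp N)
    (hB : B ∈ BVB.PiClass A) :
    IsCompactOperator (BVB.BV.toL1 B (BVB.Q N)) := by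
  -- By completeness of `L¹`, the closure of the totally bounded image is compact; its preimage
  -- contains the unit ball, a neighbourhood of `0`.
  refine ⟨closure (BVB.BV.toL1 B (BVB.Q N) '' Metric.closedBall 0 1), ?_, ?_⟩
  · exact TotallyBounded.isCompact_of_isClosed
      (BVB.totallyBounded_image_toL1 B hB.finite_nullSpace).closure isClosed_closure
  · exact Filter.mem_of_superset (Metric.closedBall_mem_nhds 0 one_pos) fun b hb =>
      subset_closure (Set.mem_image_of_mem _ hb)
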